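/- Let $p$ be a prime and $k$ an algebraic closure of $\mathbf{F}_p$. Let $J$ be the antidiagonal $2\times 2$ matrix with entries $1$ on the antidiagonal, $\Psi=\begin{pmatrix}0&-J\\ J&0\end{pmatrix}$ and $G=Sp(4)=\{g\in GL_4 : {}^tg\Psi g=\Psi\}$ over $k$. Let $(u_1,\dots,u_4)$ be the canonical basis of $k^4$, let $P\subset G$ be the stabilizer of $\mathrm{Span}(u_3,u_4)$, $Q\subset G$ the stabilizer of $\mathrm{Span}(u_1,u_2)$, $L=P\cap Q$ their common Levi subgroup, and $\varphi$ the $p$-th power Frobenius. The zip group is $E=\{(x,y)\in P\times Q : \varphi(\bar x)=\bar y\}$, where $\bar x,\bar y\in L$ are the Levi components; it acts on $G$ by $(a,b)\cdot g=agb^{-1}$, and the stack of $G$-zips is $G\text{-Zip}^\mu=[E\backslash G]$. Let $B$ be the Borel subgroup of lower triangular matrices of $G$, $B_L=B\cap L$, $T$ the diagonal torus of elements $\mathrm{diag}(x_1,x_2,x_2^{-1},x_1^{-1})$, and identify $(a_1,a_2)\in\mathbf{Z}^2$ with the character $x_1^{a_1}x_2^{a_2}$ of $T$. For $\lambda\in\mathbf{Z}^2=X^*(T)$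 let $V(\lambda)=\mathrm{Ind}_{B_L}^{L}(\lambda)$ be the $L$-representation of regular functions $v$ on $L$ with $v(xb)=\lambda(b)^{-1}v(x)$ for $x\in L$, $b\in B_L$, with action $(l\cdot v)(x)=v(l^{-1}x)$; it is a representation of $E$ through $E\to P\to L$, and defines a vector bundle $\mathscr{V}(\lambda)$ on $[E\backslash G]$, whose global sections are $$H^0(G\text{-Zip}^\mu,\mathscr{V}(\lambda))=\{f:G\to V(\lambda)\ \text{regular} : f(\varepsilon\cdot g)=\varepsilon f(g)\ \ \forall \varepsilon\in E,\ g\in G\}.$$ Let $$R_{\rm zip}=\bigoplus_{\lambda=(a_1,a_2),\ a_1\ge a_2} H^0(G\text{-Zip}^\mu,\mathscr{V}(\lambda))$$ be the ring of zip automorphic forms, a $k$-algebra via the maps $V(\lambda)\otimes V(\nu)\to V(\lambda+\nu)$ given by multiplication of functions. Theorem. (1) The $k$-algebra homomorphism $\iota$ from $R_{\rm zip}$ to the algebra of $k$-valued functions on $G$, $(f_\lambda)_\lambda\mapsto\bigl(g\mapsto\sum_\lambda f_\lambda(g)(1)\bigr)$, is injective. Writing $A(g)$ for the upper left $2\times2$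 block of $g\in G$, pull-back of polynomial functions along $A:G\to M_2$, $F\mapsto F\circ A$, is injective on $k[a_{11},a_{12},a_{21},a_{22}]$. (2) Under these identifications, $$R_{\rm zip}=k[\alpha,\Delta_1,\Delta_2]\subset k[a_{11},a_{12},a_{21},a_{22}],$$ where $\Delta_1=a_{12}$, $\Delta_2=a_{11}a_{22}-a_{12}a_{21}$ and $\alpha=a_{11}\Delta_1^{p-1}+a_{22}^p$; that is, there is an isomorphism of $k$-algebras $e:R_{\rm zip}\to k[\alpha,\Delta_1,\Delta_2]$ with $\iota(s)=e(s)\circ A$ for all $s\in R_{\rm zip}$. (3) The elements $\alpha,\Delta_1,\Delta_2$ are algebraically independent over $k$; in particular $R_{\rm zip}$ is isomorphic to a polynomial ring over $k$ in three variables. -/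

import Mathlib

open Matrix

/-- Invertible matrices of size `2n`; the index set `Fin n ⊕ Fin n` is ordered lexicographically,
so that `inl 0, …, inl (n-1), inr 0, …, inr (n-1)` stand for `1, …, 2n`. -/
abbrev GLBlock (n : ℕ) (k : Type*) [Field k] := Matrix.GeneralLinearGroup (Fin n ⊕ Fin n) k

section Groups

variable (n : ℕ) (k : Type*) [Field k]

/-- The antidiagonal matrix `J` of size `n`. -/
def antiDiag : Matrix (Fin n) (Fin n) k := Matrix.of fun i j => if j = Fin.rev i then 1 else 0

/-- The matrix `Ψ = (0, -J; J, 0)` of the symplectic form. -/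
def sympForm : Matrix (Fin n ⊕ Fin n) (Fin n ⊕ Fin n) k :=
  Matrix.fromBlocks 0 (-antiDiag n k) (antiDiag n k) 0

/-- `G = Sp(2n)`: the invertible `g` with `ᵗg Ψ g = Ψ`. -/
def symp : Subgroup (GLBlock n k) where
  carrier := {g | g.valᵀ * sympForm n k * g.val = sympForm n k}
  one_mem' := by simp
  mul_mem' := by
    intro a b ha hb
    simp only [Set.mem_ofPred_eq] at ha hb ⊢
    rw [Units.val_mul, Matrix.transpose_mul]
    calc b.valᵀ * a.valᵀ * sympForm n k *
          (a.val * b.val)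
        = b.valᵀ * (a.valᵀ * sympForm n k * a.val) *
          b.val := by simp only [Matrix.mul_assoc]
      _ = sympForm n k := by rw [ha, hb]
  inv_mem' := by
    intro a ha
    simp only [Set.mem_ofPred_eq] at ha ⊢
    have h1 : a.val * (a⁻¹ : GLBlock n k).val = 1 := by
      rw [← Units.val_mul, mul_inv_cancel, Units.val_one]
    have h2 : (a⁻¹ : GLBlock n k).valᵀ * a.valᵀ = 1 := by
      rw [← Matrix.transpose_mul, h1, Matrix.transpose_one]
    calc (a⁻¹ : GLBlock n k).valᵀ * sympForm n k * (a⁻¹ : GLBlock n k).val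
        = (a⁻¹ : GLBlock n k).valᵀ *
            (a.valᵀ * sympForm n k * a.val) *
            (a⁻¹ : GLBlock n k).val := by rw [ha]
      _ = ((a⁻¹ : GLBlock n k).valᵀ * a.valᵀ) * sympForm n k *
            (a.val * (a⁻¹ : GLBlock n k).val) := by
          simp only [Matrix.mul_assoc]
      _ = sympForm n k := by rw [h1, h2, Matrix.one_mul, Matrix.mul_one]

variable {n k} in
/-- The stabilizer of a subspace of `k^{2n}`. -/
def stabSubspace (W : Submodule k (Fin n ⊕ Fin n → k)) : Subgroup (GLBlock n k) where
  carrier := {g | W.map (Matrix.mulVecLin g.val) = W}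
  one_mem' := by simp
  mul_mem' := by
    intro a b ha hb
    simp only [Set.mem_ofPred_eq] at ha hb ⊢
    rw [Units.val_mul, Matrix.mulVecLin_mul, Submodule.map_comp, hb, ha]
  inv_mem' := by
    intro a ha
    simp only [Set.mem_ofPred_eq] at ha ⊢
    conv_lhs => rw [← ha]
    rw [← Submodule.map_comp, ← Matrix.mulVecLin_mul, ← Units.val_mul, inv_mul_cancel]
    simp

/-- The span of the last `n` vectors `u_{n+1}, …, u_{2n}` of the canonical basis. -/
def lastSpan : Submodule k (Fin n ⊕ Fin n → k) :=
  Submodule.span k (Set.range fun i : Fin n => Pi.single (Sum.inr i) (1 : k))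

/-- The span of the first `n` vectors `u_1, …, u_n` of the canonical basis. -/
def firstSpan : Submodule k (Fin n ⊕ Fin n → k) :=
  Submodule.span k (Set.range fun i : Fin n => Pi.single (Sum.inl i) (1 : k))

/-- The parabolic subgroup `P` of `G`, the stabilizer of `Span(u_{n+1}, …, u_{2n})`. -/
def parP : Subgroup (GLBlock n k) := symp n k ⊓ stabSubspace (lastSpan n k)

/-- The opposite parabolic subgroup `Q` of `G`, the stabilizer of `Span(u_1, …, u_n)`. -/
def parQ : Subgroup (GLBlock n k) := symp n k ⊓ stabSubspace (firstSpan n k)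

/-- The common Levi subgroup `L = P ∩ Q`. -/
def levi : Subgroup (GLBlock n k) := parP n k ⊓ parQ n k

/-- The lower triangular invertible matrices. -/
def lowerTri : Subgroup (GLBlock n k) where
  carrier := {g | g.val.BlockTriangular (fun i => OrderDual.toDual (toLex i))}
  one_mem' := by
    simp only [Set.mem_ofPred_eq, Units.val_one]
    exact Matrix.blockTriangular_one
  mul_mem' := by
    intro a b ha hb
    simp only [Set.mem_ofPred_eq] at ha hb ⊢
    rw [Units.val_mul]
    exact ha.mul hb
  inv_mem' := by
    intro a ha
    simp only [Set.mem_ofPred_eq] at ha ⊢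
    have : Invertible a.val := a.invertible
    rw [Matrix.coe_units_inv]
    exact Matrix.blockTriangular_inv_of_blockTriangular ha

/-- The Borel subgroup `B` of `G` of lower triangular matrices. -/
def borelG : Subgroup (GLBlock n k) := symp n k ⊓ lowerTri n k

/-- The Borel subgroup `B_L = B ∩ L` of `L`. -/
def borelLevi : Subgroup (GLBlock n k) := borelG n k ⊓ levi n k

variable {n k}

theorem mem_symp {g : GLBlock n k} : g ∈ symp n k ↔
    g.valᵀ * sympForm n k * g.val = sympForm n k := Iff.rfl

theorem mem_stab {W : Submodule k (Fin n ⊕ Fin n → k)} {g : GLBlock n k} :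
    g ∈ stabSubspace W ↔ W.map (Matrix.mulVecLin g.val) = W := Iff.rfl

theorem mem_lastSpan (v : Fin n ⊕ Fin n → k) : v ∈ lastSpan n k ↔ ∀ i, v (Sum.inl i) = 0 := by
  constructor
  · intro hv i
    have : lastSpan n k ≤ LinearMap.ker (LinearMap.proj (R := k) (φ := fun _ => k) (Sum.inl i)) := by
      rw [lastSpan, Submodule.span_le]
      rintro _ ⟨j, rfl⟩
      simp
    simpa using this hv
  · intro h
    have : v = ∑ j : Fin n, v (Sum.inr j) • Pi.single (Sum.inr j) (1 : k) := by
      ext (i | i)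
      · simp [h]
      · simp [Finset.sum_apply, Pi.single_apply]
    rw [this]
    exact Submodule.sum_mem _ fun j _ => Submodule.smul_mem _ _ (Submodule.subset_span ⟨j, rfl⟩)

theorem mem_firstSpan (v : Fin n ⊕ Fin n → k) : v ∈ firstSpan n k ↔ ∀ i, v (Sum.inr i) = 0 := by
  constructor
  · intro hv i
    have : firstSpan n k ≤ LinearMap.ker (LinearMap.proj (R := k) (φ := fun _ => k) (Sum.inr i)) := by
      rw [firstSpan, Submodule.span_le]
      rintro _ ⟨j, rfl⟩
      simp
    simpa using this hv
  · intro h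
    have : v = ∑ j : Fin n, v (Sum.inl j) • Pi.single (Sum.inl j) (1 : k) := by
      ext (i | i)
      · simp [Finset.sum_apply, Pi.single_apply]
      · simp [h]
    rw [this]
    exact Submodule.sum_mem _ fun j _ => Submodule.smul_mem _ _ (Submodule.subset_span ⟨j, rfl⟩)

theorem mem_stab_lastSpan (g : GLBlock n k) : g ∈ stabSubspace (lastSpan n k) ↔
    g.val.toBlocks₁₂ = 0 ∧ (g⁻¹ : GLBlock n k).val.toBlocks₁₂ = 0 := by
  have key : ∀ g : GLBlock n k, (lastSpan n k).map (Matrix.mulVecLin g.val) ≤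
      lastSpan n k ↔ g.val.toBlocks₁₂ = 0 := by
    intro g
    rw [Submodule.map_le_iff_le_comap]
    constructor
    · intro h
      ext i j
      have h1 : (Pi.single (Sum.inr j) (1 : k) : Fin n ⊕ Fin n → k) ∈ lastSpan n k :=
        Submodule.subset_span ⟨j, rfl⟩
      have h2 := (mem_lastSpan _).1 (h h1) i
      simpa [Matrix.toBlocks₁₂] using h2
    · intro h
      rw [lastSpan, Submodule.span_le]
      rintro _ ⟨j, rfl⟩
      refine (mem_lastSpan _).2 fun i => ?_
      have := congrFun (congrFun h i) j
      simpa [Matrix.toBlocks₁₂] using this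
  constructor
  · intro h
    exact ⟨(key g).1 (le_of_eq (mem_stab.1 h)), (key g⁻¹).1 (le_of_eq (mem_stab.1 (inv_mem h)))⟩
  · rintro ⟨h, h'⟩
    refine le_antisymm ((key g).2 h) ?_
    have h3 := Submodule.map_mono (f := Matrix.mulVecLin g.val) ((key g⁻¹).2 h')
    rwa [← Submodule.map_comp, ← Matrix.mulVecLin_mul, ← Units.val_mul, mul_inv_cancel,
      Units.val_one, Matrix.mulVecLin_one, Submodule.map_id] at h3

theorem mem_stab_firstSpan (g : GLBlock n k) : g ∈ stabSubspace (firstSpan n k) ↔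
    g.val.toBlocks₂₁ = 0 ∧ (g⁻¹ : GLBlock n k).val.toBlocks₂₁ = 0 := by
  have key : ∀ g : GLBlock n k, (firstSpan n k).map (Matrix.mulVecLin g.val) ≤
      firstSpan n k ↔ g.val.toBlocks₂₁ = 0 := by
    intro g
    rw [Submodule.map_le_iff_le_comap]
    constructor
    · intro h
      ext i j
      have h1 : (Pi.single (Sum.inl j) (1 : k) : Fin n ⊕ Fin n → k) ∈ firstSpan n k :=
        Submodule.subset_span ⟨j, rfl⟩
      have h2 := (mem_firstSpan _).1 (h h1) i
      simpa [Matrix.toBlocks₂₁] using h2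
    · intro h
      rw [firstSpan, Submodule.span_le]
      rintro _ ⟨j, rfl⟩
      refine (mem_firstSpan _).2 fun i => ?_
      have := congrFun (congrFun h i) j
      simpa [Matrix.toBlocks₂₁] using this
  constructor
  · intro h
    exact ⟨(key g).1 (le_of_eq (mem_stab.1 h)), (key g⁻¹).1 (le_of_eq (mem_stab.1 (inv_mem h)))⟩
  · rintro ⟨h, h'⟩
    refine le_antisymm ((key g).2 h) ?_
    have h3 := Submodule.map_mono (f := Matrix.mulVecLin g.val) ((key g⁻¹).2 h')
    rwa [← Submodule.map_comp, ← Matrix.mulVecLin_mul, ← Units.val_mul, mul_inv_cancel,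
      Units.val_one, Matrix.mulVecLin_one, Submodule.map_id] at h3

/-- The block diagonal part `(A, 0; 0, D)` of a matrix `(A, B; C, D)`. -/
def diagPart (M : Matrix (Fin n ⊕ Fin n) (Fin n ⊕ Fin n) k) :
    Matrix (Fin n ⊕ Fin n) (Fin n ⊕ Fin n) k :=
  Matrix.fromBlocks M.toBlocks₁₁ 0 0 M.toBlocks₂₂

theorem diagPart_one : diagPart (1 : Matrix (Fin n ⊕ Fin n) (Fin n ⊕ Fin n) k) = 1 := by
  rw [diagPart, ← Matrix.fromBlocks_one, Matrix.toBlocks_fromBlocks₁₁,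
    Matrix.toBlocks_fromBlocks₂₂]

theorem diagPart_mul (M N : Matrix (Fin n ⊕ Fin n) (Fin n ⊕ Fin n) k)
    (h : (M.toBlocks₁₂ = 0 ∧ N.toBlocks₁₂ = 0) ∨ (M.toBlocks₂₁ = 0 ∧ N.toBlocks₂₁ = 0)) :
    diagPart (M * N) = diagPart M * diagPart N := by
  conv_lhs => rw [← Matrix.fromBlocks_toBlocks M, ← Matrix.fromBlocks_toBlocks N]
  rw [Matrix.fromBlocks_multiply]
  rcases h with ⟨h1, h2⟩ | ⟨h1, h2⟩ <;> simp [diagPart, h1, h2, Matrix.fromBlocks_multiply]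

theorem diagPart_symp (M : Matrix (Fin n ⊕ Fin n) (Fin n ⊕ Fin n) k)
    (h : M.toBlocks₁₂ = 0 ∨ M.toBlocks₂₁ = 0) (hM : Mᵀ * sympForm n k * M = sympForm n k) :
    (diagPart M)ᵀ * sympForm n k * diagPart M = sympForm n k := by
  rw [← Matrix.fromBlocks_toBlocks M] at hM
  simp only [sympForm, diagPart, Matrix.fromBlocks_transpose, Matrix.fromBlocks_multiply,
    Matrix.fromBlocks_inj] at hM ⊢
  rcases h with h | h <;> simp [h] at hM ⊢ <;> tauto

/-- The block diagonal part of an element of a parabolic subgroup, as an invertible matrix. -/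
def diagUnit (g : GLBlock n k)
    (h : (g.val.toBlocks₁₂ = 0 ∧ (g⁻¹ : GLBlock n k).val.toBlocks₁₂ = 0) ∨
      (g.val.toBlocks₂₁ = 0 ∧ (g⁻¹ : GLBlock n k).val.toBlocks₂₁ = 0)) :
    GLBlock n k where
  val := diagPart g.val
  inv := diagPart (g⁻¹ : GLBlock n k).val
  val_inv := by rw [← diagPart_mul _ _ h, ← Units.val_mul, mul_inv_cancel, Units.val_one,
    diagPart_one]
  inv_val := by rw [← diagPart_mul _ _ (h.imp And.symm And.symm), ← Units.val_mul, inv_mul_cancel,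
    Units.val_one, diagPart_one]

theorem diagUnit_mem (g : GLBlock n k) (hg : g ∈ symp n k) (h) : diagUnit g h ∈ levi n k := by
  have h1 : diagUnit g h ∈ symp n k :=
    diagPart_symp _ (h.imp And.left And.left) (mem_symp.1 hg)
  refine ⟨⟨h1, (mem_stab_lastSpan _).2 ⟨?_, ?_⟩⟩, ⟨h1, (mem_stab_firstSpan _).2 ⟨?_, ?_⟩⟩⟩
  · exact Matrix.toBlocks_fromBlocks₁₂ _ _ _ _
  · exact Matrix.toBlocks_fromBlocks₁₂ _ _ _ _
  · exact Matrix.toBlocks_fromBlocks₂₁ _ _ _ _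
  · exact Matrix.toBlocks_fromBlocks₂₁ _ _ _ _

variable (n k) in
/-- The projection `P → L`, `x ↦ x̄`, onto the Levi component: since `P = L ⋉ R_u(P)` consists of
block lower triangular matrices, `x̄` is the block diagonal part of `x`. -/
def leviProjP : parP n k →* levi n k where
  toFun x := ⟨diagUnit x.1 (Or.inl ((mem_stab_lastSpan _).1 x.2.2)), diagUnit_mem _ x.2.1 _⟩
  map_one' := by
    apply Subtype.ext
    apply Units.ext
    exact diagPart_one
  map_mul' x y := by
    apply Subtype.ext
    apply Units.ext
    exact diagPart_mul _ _ (Or.inl ⟨((mem_stab_lastSpan _).1 x.2.2).1,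
      ((mem_stab_lastSpan _).1 y.2.2).1⟩)

variable (n k) in
/-- The projection `Q → L`, `y ↦ ȳ`, onto the Levi component. -/
def leviProjQ : parQ n k →* levi n k where
  toFun x := ⟨diagUnit x.1 (Or.inr ((mem_stab_firstSpan _).1 x.2.2)), diagUnit_mem _ x.2.1 _⟩
  map_one' := by
    apply Subtype.ext
    apply Units.ext
    exact diagPart_one
  map_mul' x y := by
    apply Subtype.ext
    apply Units.ext
    exact diagPart_mul _ _ (Or.inr ⟨((mem_stab_firstSpan _).1 x.2.2).1,
      ((mem_stab_firstSpan _).1 y.2.2).1⟩)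

end Groups

section ZipGroup

variable (p : ℕ) [Fact p.Prime] (n : ℕ) (k : Type*) [Field k] [CharP k p]

/-- The `p`-th power Frobenius homomorphism `φ`, raising all matrix entries to the power `p`. -/
def frobGL : GLBlock n k →* GLBlock n k := Matrix.GeneralLinearGroup.map (frobenius k p)

/-- The zip group `E = {(x, y) ∈ P × Q : φ(x̄) = ȳ}`. -/
def zipGroup : Subgroup (parP n k × parQ n k) :=
  MonoidHom.eqLocus
    ((frobGL p n k).comp ((levi n k).subtype.comp ((leviProjP n k).comp (MonoidHom.fst _ _))))
    ((levi n k).subtype.comp ((leviProjQ n k).comp (MonoidHom.snd _ _)))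

variable {n k} in
/-- The action `(a, b) · g = a g b⁻¹` of `P × Q` on `G`. -/
def zipAct (ε : parP n k × parQ n k) (g : symp n k) : symp n k :=
  ⟨ε.1 * g * (ε.2 : GLBlock n k)⁻¹,
    mul_mem (mul_mem ε.1.2.1 g.2) (inv_mem ε.2.2.1)⟩

end ZipGroup

section Sections

variable (n : ℕ) (k : Type*) [Field k]

/-- The ring `k[H]` of regular functions on a Zariski closed subgroup `H` of `GL_{2n}`: the
`k`-algebra generated by the matrix entries of `h` and of `h⁻¹`. -/
def regularFunctions {n : ℕ} {k : Type*} [Field k] (H : Subgroup (GLBlock n k)) :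
    Subalgebra k (H → k) :=
  Algebra.adjoin k
    (Set.range (fun (ij : (Fin n ⊕ Fin n) × (Fin n ⊕ Fin n)) (h : H) =>
        (h : GLBlock n k).val ij.1 ij.2) ∪
      Set.range (fun (ij : (Fin n ⊕ Fin n) × (Fin n ⊕ Fin n)) (h : H) =>
        ((h : GLBlock n k)⁻¹ : GLBlock n k).val ij.1 ij.2))

variable {n k} in
/-- The character of `T = {diag(x_1, …, x_n, x_n⁻¹, …, x_1⁻¹)}` attached to
`a = (a_1, …, a_n) ∈ ℤⁿ = X^*(T)`, namely `x_1^{a_1} ⋯ x_n^{a_n}`, extended to lower triangular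
matrices through their diagonal. -/
def weightChar (a : Fin n → ℤ) (b : GLBlock n k) : k :=
  ∏ i, (b.val (Sum.inl i) (Sum.inl i)) ^ a i

theorem weightChar_zero (b : GLBlock n k) : weightChar (0 : Fin n → ℤ) b = 1 := by
  simp [weightChar]

variable {n k} in
theorem diag_ne_zero {b : GLBlock n k} (hb : b ∈ lowerTri n k) (i : Fin n ⊕ Fin n) :
    b.val i i ≠ 0 := by
  have hb' : b⁻¹ ∈ lowerTri n k := inv_mem hb
  have h1 : (b.val * (b⁻¹ : GLBlock n k).val) i i = 1 := by
    rw [← Units.val_mul, mul_inv_cancel, Units.val_one, Matrix.one_apply_eq]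
  rw [Matrix.mul_apply, Finset.sum_eq_single i] at h1
  · exact left_ne_zero_of_mul_eq_one h1
  · intro j _ hj
    rcases lt_or_gt_of_ne (fun h => hj (toLex.injective h) : toLex j ≠ toLex i) with h | h
    · rw [hb' (OrderDual.toDual_lt_toDual.2 h), mul_zero]
    · rw [hb (OrderDual.toDual_lt_toDual.2 h), zero_mul]
  · simp

theorem weightChar_add {n : ℕ} {k : Type*} [Field k] (a a' : Fin n → ℤ) {b : GLBlock n k}
    (hb : b ∈ lowerTri n k) : weightChar (a + a') b = weightChar a b * weightChar a' b := by
  simp only [weightChar, ← Finset.prod_mul_distrib]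
  exact Finset.prod_congr rfl fun i _ => zpow_add₀ (diag_ne_zero hb _) _ _

/-- The representation `V(λ) = H⁰(L/B_L, ℒ(λ)) = Ind_{B_L}^L(λ)` of `L`: regular functions `v` on
`L` with `v(x b) = λ(b)⁻¹ v(x)` for `b ∈ B_L`. -/
def indRep (lam : Fin n → ℤ) : Submodule k (levi n k → k) where
  carrier := {v | v ∈ regularFunctions (levi n k) ∧
    ∀ x b : levi n k, (b : GLBlock n k) ∈ borelLevi n k →
      v (x * b) = (weightChar lam (b : GLBlock n k))⁻¹ * v x}
  zero_mem' := ⟨zero_mem _, by simp⟩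
  add_mem' := by
    rintro u v ⟨hu, hu'⟩ ⟨hv, hv'⟩
    refine ⟨add_mem hu hv, fun x b hb => ?_⟩
    simp only [Pi.add_apply, hu' x b hb, hv' x b hb, mul_add]
  smul_mem' := by
    rintro c v ⟨hv, hv'⟩
    refine ⟨Subalgebra.smul_mem _ hv c, fun x b hb => ?_⟩
    simp only [Pi.smul_apply, hv' x b hb, smul_eq_mul]
    ring

variable {n k} in
/-- The action of `L` on functions on `L` by left translation: `(l · v)(x) = v(l⁻¹ x)`. It makes
`V(λ)` a representation of `L`. -/
def leftTranslate (l : levi n k) (v : levi n k → k) : levi n k → k := fun x => v (l⁻¹ * x)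

theorem leftTranslate_mem {n : ℕ} {k : Type*} [Field k] (l : levi n k) {lam : Fin n → ℤ}
    {v : levi n k → k} (hv : v ∈ indRep n k lam) : leftTranslate l v ∈ indRep n k lam := by
  refine ⟨?_, fun x b hb => ?_⟩
  · have hreg : v ∈ regularFunctions (levi n k) := hv.1
    let τ : (levi n k → k) →ₐ[k] (levi n k → k) :=
      { toFun := leftTranslate l
        map_one' := rfl
        map_mul' := fun _ _ => rfl
        map_zero' := rfl
        map_add' := fun _ _ => rfl
        commutes' := fun _ => rfl }
    have hle : regularFunctions (levi n k) ≤ (regularFunctions (levi n k)).comap τ := by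
      conv_lhs => rw [regularFunctions]
      rw [Algebra.adjoin_le_iff]
      rintro _ (⟨⟨i, j⟩, rfl⟩ | ⟨⟨i, j⟩, rfl⟩)
      · have : τ (fun h : levi n k => (h : GLBlock n k).val i j) =
            ∑ m : Fin n ⊕ Fin n, ((l : GLBlock n k)⁻¹ : GLBlock n k).val i m •
              (fun h : levi n k => (h : GLBlock n k).val m j) := by
          funext x
          simp only [Finset.sum_apply, Pi.smul_apply, smul_eq_mul]
          exact Matrix.mul_apply (M := ((l : GLBlock n k)⁻¹ : GLBlock n k).val)
            (N := (x : GLBlock n k).val)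
        rw [SetLike.mem_coe, Subalgebra.mem_comap, this]
        refine Subalgebra.sum_mem _ fun m _ => Subalgebra.smul_mem (regularFunctions (levi n k)) ?_ _
        exact (Algebra.subset_adjoin (Or.inl ⟨(m, j), rfl⟩))
      · have : τ (fun h : levi n k => ((h : GLBlock n k)⁻¹ : GLBlock n k).val i j) =
            ∑ m, (l : GLBlock n k).val m j •
              (fun h : levi n k => ((h : GLBlock n k)⁻¹ : GLBlock n k).val i m) := by
          funext x
          simp only [Finset.sum_apply, Pi.smul_apply, smul_eq_mul]
          have h1 : (((l⁻¹ * x : levi n k) : GLBlock n k))⁻¹ = (x : GLBlock n k)⁻¹ * l := by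
            simp
          change (((l⁻¹ * x : levi n k) : GLBlock n k)⁻¹ : GLBlock n k).val i j = _
          rw [h1, Units.val_mul, Matrix.mul_apply]
          exact Finset.sum_congr rfl fun m _ => mul_comm _ _
        rw [SetLike.mem_coe, Subalgebra.mem_comap, this]
        refine Subalgebra.sum_mem _ fun m _ => Subalgebra.smul_mem (regularFunctions (levi n k)) ?_ _
        exact (Algebra.subset_adjoin (Or.inr ⟨(i, m), rfl⟩))
    exact hle hreg
  · simp only [leftTranslate, ← mul_assoc]
    exact hv.2 _ _ hb

/-- Regular maps `G → V(λ)`, that is, the image of `k[G] ⊗ V(λ)` in the space of all maps; a map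
with values in functions on `L` is written `g ↦ x ↦ f g x`. -/
def regularMaps (lam : Fin n → ℤ) : Submodule k (symp n k → levi n k → k) :=
  Submodule.span k
    {f | ∃ c ∈ regularFunctions (symp n k), ∃ v ∈ indRep n k lam, f = fun g => c g • v}

end Sections

section ZipRing

variable (p : ℕ) [Fact p.Prime] (n : ℕ) (k : Type*) [Field k] [CharP k p]

/-- The space `H⁰(G-Zip^μ, 𝒱(λ))` of global sections over the quotient stack `[E \ G]` of the
vector bundle attached to the representation `V(λ)`, on which `E` acts through
`E → P → L`: regular maps `f : G → V(λ)` with `f(ε · g) = ε f(g)` for all `ε ∈ E`, `g ∈ G`. -/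
def zipSections (lam : Fin n → ℤ) : Submodule k (symp n k → levi n k → k) where
  carrier := {f | f ∈ regularMaps n k lam ∧ ∀ ε ∈ zipGroup p n k, ∀ g : symp n k,
    f (zipAct ε g) = leftTranslate (leviProjP n k ε.1) (f g)}
  zero_mem' := ⟨zero_mem _, fun _ _ _ => rfl⟩
  add_mem' := by
    rintro u v ⟨hu, hu'⟩ ⟨hv, hv'⟩
    refine ⟨add_mem hu hv, fun ε hε g => ?_⟩
    rw [Pi.add_apply, hu' ε hε g, hv' ε hε g]
    rfl
  smul_mem' := by
    rintro c v ⟨hv, hv'⟩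
    refine ⟨Submodule.smul_mem _ c hv, fun ε hε g => ?_⟩
    rw [Pi.smul_apply, hv' ε hε g]
    rfl

/-- The `L`-dominant characters `X^*_{+,I}(T) = {(a_1, …, a_n) : a_1 ≥ ⋯ ≥ a_n}`. -/
def domWeights (n : ℕ) : AddSubmonoid (Fin n → ℤ) where
  carrier := {a | Antitone a}
  zero_mem' := antitone_const
  add_mem' ha hb := Antitone.add ha hb

theorem indRep_mul {n : ℕ} {k : Type*} [Field k] {a a' : Fin n → ℤ} {v v' : levi n k → k}
    (hv : v ∈ indRep n k a) (hv' : v' ∈ indRep n k a') : v * v' ∈ indRep n k (a + a') := by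
  refine ⟨mul_mem hv.1 hv'.1, fun x b hb => ?_⟩
  rw [Pi.mul_apply, hv.2 x b hb, hv'.2 x b hb, weightChar_add a a' hb.1.2, mul_inv, Pi.mul_apply]
  ring

theorem regularMaps_mul {n : ℕ} {k : Type*} [Field k] {a a' : Fin n → ℤ}
    {f f' : symp n k → levi n k → k}
    (hf : f ∈ regularMaps n k a) (hf' : f' ∈ regularMaps n k a') :
    f * f' ∈ regularMaps n k (a + a') := by
  have h := Submodule.mul_mem_mul hf hf'
  rw [regularMaps, regularMaps, Submodule.span_mul_span] at h
  refine Submodule.span_mono ?_ h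
  rintro _ ⟨_, ⟨c, hc, v, hv, rfl⟩, _, ⟨c', hc', v', hv', rfl⟩, rfl⟩
  refine ⟨c * c', mul_mem hc hc', v * v', indRep_mul hv hv', ?_⟩
  funext g x
  simp only [Pi.mul_apply, Pi.smul_apply, smul_eq_mul]
  ring

/-- Multiplication of sections along `V(λ) ⊗ V(ν) → V(λ + ν)`, the multiplication of functions on
`L`. -/
instance zipSections_graded :
    SetLike.GradedMonoid (fun lam : domWeights n => zipSections p n k (lam : Fin n → ℤ)) where
  one_mem := by
    refine ⟨Submodule.subset_span ⟨1, one_mem _, 1, ⟨one_mem _, fun x b _ => ?_⟩, ?_⟩,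
      fun _ _ _ => rfl⟩
    · simp [weightChar]
    · funext g x
      simp
  mul_mem := by
    rintro a a' f f' ⟨hf, hf'⟩ ⟨hg, hg'⟩
    refine ⟨regularMaps_mul hf hg, fun ε hε g => ?_⟩
    rw [Pi.mul_apply, hf' ε hε g, hg' ε hε g]
    rfl

/-- The ring of zip automorphic forms
`R_zip = ⨁_λ H⁰(G-Zip^μ, 𝒱(λ))`, with `λ` running through `X^*_{+,I}(T)`. -/
abbrev zipRing : Type _ :=
  DirectSum (domWeights n) fun lam => zipSections p n k (lam : Fin n → ℤ)

/-- The homomorphism `ι : (f_λ)_λ ↦ ∑_λ f_λ` from `R_zip` to functions on `G`, where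
`f_λ ∈ H⁰(G-Zip^μ, 𝒱(λ))` is viewed as the scalar function `g ↦ f_λ(g)(1)` (the corresponding
section of `ℒ(λ)` on the stack of zip flags). -/
noncomputable def zipRingToFun : zipRing p n k →ₐ[k] (symp n k → k) :=
  ((Pi.evalAlgHom k (fun _ : levi n k => k) 1).compLeft (symp n k)).comp
    (DirectSum.coeAlgHom fun lam : domWeights n => zipSections p n k (lam : Fin n → ℤ))

end ZipRing

section Polynomials

variable (n : ℕ) (k : Type*) [Field k]

/-- Pull-back of polynomial functions along `G → M_n`, `(A, B; C, D) ↦ A`. -/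
noncomputable def pullbackA : MvPolynomial (Fin n × Fin n) k →ₐ[k] (symp n k → k) :=
  MvPolynomial.aeval fun (ij : Fin n × Fin n) (g : symp n k) =>
    (g : GLBlock n k).val (Sum.inl ij.1) (Sum.inl ij.2)

/-- `Δ_i`: the minor of the generic matrix `(a_{r,s})` on the first `i` rows and last `i`
columns. -/
noncomputable def cornerMinor (i : ℕ) (hi : i ≤ n) : MvPolynomial (Fin n × Fin n) k :=
  ((Matrix.mvPolynomialX (Fin n) (Fin n) k).submatrix (Fin.castLE hi)
    (fun j : Fin i => ⟨n - i + j, by omega⟩)).det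

/-- `α = a_{1,1} Δ_1^{p-1} + a_{2,2}^p` in `k[a_{1,1}, a_{1,2}, a_{2,1}, a_{2,2}]`. -/
noncomputable def alphaPoly (p : ℕ) (k : Type*) [Field k] : MvPolynomial (Fin 2 × Fin 2) k :=
  MvPolynomial.X (0, 0) * cornerMinor 2 k 1 (by norm_num) ^ (p - 1) + MvPolynomial.X (1, 1) ^ p

end Polynomials

/-!
Write `A(g)` for the upper left block of `g ∈ G` and `F(g) = f(g)(1)` for a section `f` of `𝒱(λ)`.
Equivariance under the zip group `E` says that `f(g)(l) = F(x⁻¹ g y)` whenever `(x, y) ∈ E` has Levi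
component `x̄ = l` (`zipSections_apply_one`). So `f` is determined by `F`, and `F` is invariant under
`R_u(P) × R_u(Q)` and has weight `λ` under `B_L`, which acts on `A` by `A ↦ b⁻¹ A φ(b)`.

Distinct weights give distinct characters of the torus, hence `ι` is injective by the linear
independence of characters (`zipRingToFun_injective`).

For the upper bound on the image, only the invariance of `F` under the two unipotent radicals and
the unipotent radical of `B_L` is used. On the open cell `det A ≠ 0` the function `F` depends on `A`
only, and `det(A)^N F = H(A)` for a polynomial `H`. If moreover `b = a_{12}` is nonzero, the unipotent
radical of `B_L` moves `A` to the matrix with rows `(α / b^{p-1}, b)` and `(-Δ_2 / b, 0)`. This normal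
form lifts to a family in `G` whose entries are polynomial in `Δ_2` (`sliceElement`), so that
`b^m F = R(α, b, Δ_2)` without any denominator in `Δ_2`. Comparison gives `b^m H = Δ_2^N R(α, b, Δ_2)`;
modulo `b` the elements `α` and `Δ_2` become `a_{22}^p` and `a_{11} a_{22}`, which are algebraically
independent, so `b^m` can be cancelled within `k[α, Δ_1, Δ_2]` (`exists_eq_of_X_pow_mul_eq`). Hence `F`
is a polynomial in `α, Δ_1, Δ_2` on the open cell, and on `G` because the cell is dense
(`eq_of_eq_on_isUnit_det`): a curve `g · (1, 0; t S, 1)` leads from any `g` into it.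

For the lower bound, a polynomial `P` of weight `λ` under lower triangular matrices yields the section
`f(g)(l) = P(A(l)⁻¹ A(g) φ(A(l)))` (`exists_zipSection`). This applies to `α`, `Δ_1` and `Δ_2`, whose
weights are dominant. Algebraic independence is seen by evaluating at the normal form above.
-/

/-! ### Symplectic matrices and the open cell -/

section Symplectic

variable {n : ℕ} {k : Type*} [Field k]

theorem antiDiag_mul_apply (M : Matrix (Fin n) (Fin n) k) (i j : Fin n) :
    (antiDiag n k * M) i j = M (Fin.rev i) j := by
  simp [Matrix.mul_apply, antiDiag]

theorem mul_antiDiag_apply (M : Matrix (Fin n) (Fin n) k) (i j : Fin n) :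
    (M * antiDiag n k) i j = M i (Fin.rev j) := by
  rw [Matrix.mul_apply, Finset.sum_eq_single (Fin.rev j)]
  · simp [antiDiag]
  · intro l _ hl
    have : j ≠ Fin.rev l := fun h => hl (by rw [h, Fin.rev_rev])
    simp [antiDiag, this]
  · simp

theorem antiDiag_mul_antiDiag : antiDiag n k * antiDiag n k = 1 := by
  ext i j
  rw [antiDiag_mul_apply]
  simp [antiDiag, Matrix.one_apply, eq_comm]

theorem antiDiag_transpose : (antiDiag n k)ᵀ = antiDiag n k := by
  ext i j
  simp only [antiDiag, Matrix.transpose_apply, Matrix.of_apply]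
  congr 1
  exact propext ⟨fun h => by rw [h, Fin.rev_rev], fun h => by rw [h, Fin.rev_rev]⟩

theorem sympForm_mul_sympForm : sympForm n k * sympForm n k = -1 := by
  rw [sympForm, Matrix.fromBlocks_multiply, ← Matrix.fromBlocks_one, Matrix.fromBlocks_neg]
  simp [antiDiag_mul_antiDiag]

/-- The matrix `-Ψ ᵗX Ψ`, which inverts `X` when `X` is symplectic. -/
def sympInv (X : Matrix (Fin n ⊕ Fin n) (Fin n ⊕ Fin n) k) :
    Matrix (Fin n ⊕ Fin n) (Fin n ⊕ Fin n) k :=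
  -(sympForm n k * Xᵀ * sympForm n k)

theorem sympInv_mul {X : Matrix (Fin n ⊕ Fin n) (Fin n ⊕ Fin n) k}
    (h : Xᵀ * sympForm n k * X = sympForm n k) : sympInv X * X = 1 := by
  rw [sympInv, Matrix.neg_mul, Matrix.mul_assoc, Matrix.mul_assoc, ← Matrix.mul_assoc Xᵀ, h,
    sympForm_mul_sympForm, neg_neg]

/-- The element of `G` with a given symplectic matrix. -/
def sympMk (X : Matrix (Fin n ⊕ Fin n) (Fin n ⊕ Fin n) k)
    (h : Xᵀ * sympForm n k * X = sympForm n k) : symp n k :=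
  ⟨⟨X, sympInv X, mul_eq_one_comm.1 (sympInv_mul h), sympInv_mul h⟩, h⟩

@[simp]
theorem sympMk_val (X : Matrix (Fin n ⊕ Fin n) (Fin n ⊕ Fin n) k) (h) :
    (sympMk X h : GLBlock n k).val = X := rfl

theorem val_inv_of_mem_symp {g : GLBlock n k} (hg : g ∈ symp n k) :
    (g⁻¹ : GLBlock n k).val = sympInv g.val :=
  (left_inv_eq_right_inv (sympInv_mul hg) (by rw [← Units.val_mul, mul_inv_cancel]; rfl)).symm

theorem sympInv_fromBlocks (A B C D : Matrix (Fin n) (Fin n) k) :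
    sympInv (fromBlocks A B C D) =
      fromBlocks (antiDiag n k * Dᵀ * antiDiag n k) (-(antiDiag n k * Bᵀ * antiDiag n k))
        (-(antiDiag n k * Cᵀ * antiDiag n k)) (antiDiag n k * Aᵀ * antiDiag n k) := by
  simp [sympInv, sympForm, Matrix.fromBlocks_transpose, Matrix.fromBlocks_multiply,
    Matrix.fromBlocks_neg]

theorem fromBlocks_symp_iff (A B C D : Matrix (Fin n) (Fin n) k) :
    (fromBlocks A B C D)ᵀ * sympForm n k * fromBlocks A B C D = sympForm n k ↔
      (Cᵀ * antiDiag n k * A = Aᵀ * antiDiag n k * C ∧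
        Aᵀ * antiDiag n k * D - Cᵀ * antiDiag n k * B = antiDiag n k) ∧
      (Dᵀ * antiDiag n k * A - Bᵀ * antiDiag n k * C = antiDiag n k ∧
        Dᵀ * antiDiag n k * B = Bᵀ * antiDiag n k * D) := by
  simp only [sympForm, Matrix.fromBlocks_transpose, Matrix.fromBlocks_multiply,
    Matrix.fromBlocks_inj, Matrix.mul_zero, Matrix.mul_neg, Matrix.neg_mul, zero_add, add_zero,
    ← sub_eq_add_neg, sub_eq_zero]
  constructor
  · rintro ⟨h1, h2, h3, h4⟩
    refine ⟨⟨h1, ?_⟩, h3, h4⟩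
    rw [← neg_inj, ← h2]; abel
  · rintro ⟨⟨h1, h2⟩, h3, h4⟩
    exact ⟨h1, by rw [← neg_sub, h2], h3, h4⟩

theorem toBlocks₁₂_inv {g : GLBlock n k} (hg : g ∈ symp n k) (h : g.val.toBlocks₁₂ = 0) :
    (g⁻¹ : GLBlock n k).val.toBlocks₁₂ = 0 := by
  rw [val_inv_of_mem_symp hg, ← Matrix.fromBlocks_toBlocks g.val, sympInv_fromBlocks, h]
  simp

theorem toBlocks₂₁_inv {g : GLBlock n k} (hg : g ∈ symp n k) (h : g.val.toBlocks₂₁ = 0) :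
    (g⁻¹ : GLBlock n k).val.toBlocks₂₁ = 0 := by
  rw [val_inv_of_mem_symp hg, ← Matrix.fromBlocks_toBlocks g.val, sympInv_fromBlocks, h]
  simp

theorem mem_parP_of {g : GLBlock n k} (hg : g ∈ symp n k) (h : g.val.toBlocks₁₂ = 0) :
    g ∈ parP n k :=
  ⟨hg, (mem_stab_lastSpan g).2 ⟨h, toBlocks₁₂_inv hg h⟩⟩

theorem mem_parQ_of {g : GLBlock n k} (hg : g ∈ symp n k) (h : g.val.toBlocks₂₁ = 0) :
    g ∈ parQ n k :=
  ⟨hg, (mem_stab_firstSpan g).2 ⟨h, toBlocks₂₁_inv hg h⟩⟩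

theorem toBlocks₁₂_of_mem_parP {g : GLBlock n k} (hg : g ∈ parP n k) : g.val.toBlocks₁₂ = 0 :=
  ((mem_stab_lastSpan g).1 hg.2).1

theorem toBlocks₂₁_of_mem_parQ {g : GLBlock n k} (hg : g ∈ parQ n k) : g.val.toBlocks₂₁ = 0 :=
  ((mem_stab_firstSpan g).1 hg.2).1

/-- The upper left `n × n` block `A` of `g = (A, B; C, D)`. -/
def upperLeft (g : GLBlock n k) : Matrix (Fin n) (Fin n) k := g.val.toBlocks₁₁

theorem upperLeft_mul_of_left {g h : GLBlock n k} (hg : g.val.toBlocks₁₂ = 0) :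
    upperLeft (g * h) = upperLeft g * upperLeft h := by
  rw [upperLeft, Units.val_mul, ← Matrix.fromBlocks_toBlocks g.val,
    ← Matrix.fromBlocks_toBlocks h.val, Matrix.fromBlocks_multiply, hg]
  simp [upperLeft]

theorem upperLeft_mul_of_right {g h : GLBlock n k} (hh : h.val.toBlocks₂₁ = 0) :
    upperLeft (g * h) = upperLeft g * upperLeft h := by
  rw [upperLeft, Units.val_mul, ← Matrix.fromBlocks_toBlocks g.val,
    ← Matrix.fromBlocks_toBlocks h.val, Matrix.fromBlocks_multiply, hh]
  simp [upperLeft]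

theorem upperLeft_one : upperLeft (1 : GLBlock n k) = 1 := by
  rw [upperLeft, Units.val_one, ← Matrix.fromBlocks_one, Matrix.toBlocks_fromBlocks₁₁]

theorem upperLeft_inv_mul {g : GLBlock n k} (hg : g ∈ symp n k)
    (h : g.val.toBlocks₁₂ = 0 ∨ g.val.toBlocks₂₁ = 0) :
    upperLeft g⁻¹ * upperLeft g = 1 := by
  rcases h with h | h
  · rw [← upperLeft_mul_of_left (toBlocks₁₂_inv hg h), inv_mul_cancel, upperLeft_one]
  · rw [← upperLeft_mul_of_right h, inv_mul_cancel, upperLeft_one]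

/-- The lower right block of an element of a parabolic subgroup is determined by the upper left
one. -/
theorem toBlocks₂₂_eq {g : GLBlock n k} (hg : g ∈ symp n k)
    (h : g.val.toBlocks₁₂ = 0 ∨ g.val.toBlocks₂₁ = 0) :
    g.val.toBlocks₂₂ = antiDiag n k * ((upperLeft g)⁻¹)ᵀ * antiDiag n k := by
  have h1 : (upperLeft g)ᵀ * antiDiag n k * g.val.toBlocks₂₂ = antiDiag n k := by
    have := (fromBlocks_symp_iff g.val.toBlocks₁₁ g.val.toBlocks₁₂ g.val.toBlocks₂₁
      g.val.toBlocks₂₂).1 (by rw [Matrix.fromBlocks_toBlocks]; exact hg)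
    have h2 := this.1.2
    rcases h with h | h <;> simpa [upperLeft, h] using h2
  have h3 : (upperLeft g)⁻¹ * upperLeft g = 1 := by
    rw [Matrix.inv_eq_left_inv (upperLeft_inv_mul hg h), upperLeft_inv_mul hg h]
  have h4 : ((upperLeft g)⁻¹)ᵀ * (upperLeft g)ᵀ = 1 := by
    rw [← Matrix.transpose_mul, mul_eq_one_comm.1 h3, Matrix.transpose_one]
  calc g.val.toBlocks₂₂
      = antiDiag n k * (((upperLeft g)⁻¹)ᵀ * (upperLeft g)ᵀ) *
          (antiDiag n k * g.val.toBlocks₂₂) := by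
        rw [h4, Matrix.mul_one, ← Matrix.mul_assoc, antiDiag_mul_antiDiag, Matrix.one_mul]
    _ = antiDiag n k * ((upperLeft g)⁻¹)ᵀ *
          ((upperLeft g)ᵀ * antiDiag n k * g.val.toBlocks₂₂) := by
        simp only [Matrix.mul_assoc]
    _ = _ := by rw [h1]

theorem unipLower_symp {X : Matrix (Fin n) (Fin n) k}
    (hX : Xᵀ * antiDiag n k = antiDiag n k * X) :
    (fromBlocks 1 0 X 1)ᵀ * sympForm n k * fromBlocks 1 0 X 1 = sympForm n k := by
  rw [fromBlocks_symp_iff]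
  simp [hX]

theorem unipUpper_symp {X : Matrix (Fin n) (Fin n) k}
    (hX : Xᵀ * antiDiag n k = antiDiag n k * X) :
    (fromBlocks 1 X 0 1)ᵀ * sympForm n k * fromBlocks 1 X 0 1 = sympForm n k := by
  rw [fromBlocks_symp_iff]
  simp [hX]

theorem leviBlocks_symp {M : Matrix (Fin n) (Fin n) k} (hM : IsUnit M.det) :
    (fromBlocks M 0 0 (antiDiag n k * (M⁻¹)ᵀ * antiDiag n k))ᵀ * sympForm n k *
      fromBlocks M 0 0 (antiDiag n k * (M⁻¹)ᵀ * antiDiag n k) = sympForm n k := by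
  rw [fromBlocks_symp_iff]
  have h1 : Mᵀ * (M⁻¹)ᵀ = 1 := by
    rw [← Matrix.transpose_mul, Matrix.nonsing_inv_mul _ hM, Matrix.transpose_one]
  refine ⟨⟨by simp, ?_⟩, ?_, by simp⟩
  · calc Mᵀ * antiDiag n k * (antiDiag n k * (M⁻¹)ᵀ * antiDiag n k) -
          0ᵀ * antiDiag n k * 0
        = Mᵀ * (antiDiag n k * antiDiag n k) * (M⁻¹)ᵀ * antiDiag n k := by
          simp [Matrix.mul_assoc]
      _ = antiDiag n k := by rw [antiDiag_mul_antiDiag, Matrix.mul_one, h1, Matrix.one_mul]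
  · calc (antiDiag n k * (M⁻¹)ᵀ * antiDiag n k)ᵀ * antiDiag n k * M -
          0ᵀ * antiDiag n k * 0
        = antiDiag n k * (M⁻¹ * ((antiDiag n k * antiDiag n k) * M)) := by
          simp [Matrix.mul_assoc, Matrix.transpose_mul, antiDiag_transpose]
      _ = antiDiag n k := by
          rw [antiDiag_mul_antiDiag, Matrix.one_mul, Matrix.nonsing_inv_mul _ hM, Matrix.mul_one]

/-- The element of the Levi subgroup `L ≅ GL_n` with upper left block `M`, as an element of
`G`. -/
noncomputable def leviSymp (M : Matrix (Fin n) (Fin n) k) (hM : IsUnit M.det) : symp n k :=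
  sympMk _ (leviBlocks_symp hM)

theorem leviSymp_val (M : Matrix (Fin n) (Fin n) k) (hM : IsUnit M.det) :
    (leviSymp M hM : GLBlock n k).val =
      fromBlocks M 0 0 (antiDiag n k * (M⁻¹)ᵀ * antiDiag n k) := rfl

@[simp]
theorem upperLeft_leviSymp (M : Matrix (Fin n) (Fin n) k) (hM : IsUnit M.det) :
    upperLeft (leviSymp M hM : GLBlock n k) = M := by
  rw [upperLeft, leviSymp_val, Matrix.toBlocks_fromBlocks₁₁]

/-- The open cell `det A ≠ 0` of `G` is `R_u(P) · L · R_u(Q)`. -/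
theorem exists_unip_mul_leviSymp (g : symp n k) (hA : IsUnit (upperLeft (g : GLBlock n k)).det) :
    ∃ X Y : Matrix (Fin n) (Fin n) k, ∃ hX : Xᵀ * antiDiag n k = antiDiag n k * X,
      ∃ hY : Yᵀ * antiDiag n k = antiDiag n k * Y,
        g = sympMk _ (unipLower_symp hX) * leviSymp _ hA * sympMk _ (unipUpper_symp hY) := by
  obtain ⟨g, hg⟩ := g
  set A := upperLeft g with hAdef
  have hgb : g.val = fromBlocks A g.val.toBlocks₁₂ g.val.toBlocks₂₁ g.val.toBlocks₂₂ :=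
    (Matrix.fromBlocks_toBlocks g.val).symm
  generalize g.val.toBlocks₁₂ = B at hgb
  generalize g.val.toBlocks₂₁ = C at hgb
  generalize g.val.toBlocks₂₂ = D at hgb
  have hg' := mem_symp.1 hg
  rw [hgb, fromBlocks_symp_iff] at hg'
  obtain ⟨⟨h1, h2⟩, h3, h4⟩ := hg'
  have hAi : A * A⁻¹ = 1 := Matrix.mul_nonsing_inv _ hA
  have hAi' : A⁻¹ * A = 1 := Matrix.nonsing_inv_mul _ hA
  have hAt : (A⁻¹)ᵀ * Aᵀ = 1 := by rw [← Matrix.transpose_mul, hAi, Matrix.transpose_one]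
  have hX : (C * A⁻¹)ᵀ * antiDiag n k = antiDiag n k * (C * A⁻¹) := by
    calc (C * A⁻¹)ᵀ * antiDiag n k = (A⁻¹)ᵀ * (Cᵀ * antiDiag n k * A) * A⁻¹ := by
          simp only [Matrix.mul_assoc, hAi, Matrix.transpose_mul, Matrix.mul_one]
      _ = ((A⁻¹)ᵀ * Aᵀ) * antiDiag n k * (C * A⁻¹) := by rw [h1]; simp only [Matrix.mul_assoc]
      _ = _ := by rw [hAt, Matrix.one_mul]
  -- dividing `g` by the lower unipotent factor leaves an element `(A, B; 0, D')` of `Q`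
  let x := sympMk _ (unipLower_symp hX)
  let h : symp n k := x⁻¹ * ⟨g, hg⟩
  have hxi : (x⁻¹ : GLBlock n k).val = fromBlocks 1 0 (-(C * A⁻¹)) 1 := by
    refine (left_inv_eq_right_inv (a := x.1.val) ?_ ?_).symm
    · change _ * fromBlocks 1 0 (C * A⁻¹) 1 = 1
      simp [Matrix.fromBlocks_multiply]
    · rw [← Units.val_mul, mul_inv_cancel]; rfl
  have hval : (h : GLBlock n k).val = fromBlocks A B 0 (D - C * A⁻¹ * B) := by
    change ((x⁻¹ : GLBlock n k) * g).val = _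
    rw [Units.val_mul, hxi, hgb, Matrix.fromBlocks_multiply]
    simp only [Matrix.one_mul, Matrix.zero_mul, add_zero, Matrix.neg_mul, Matrix.mul_assoc, hAi',
      Matrix.mul_one, neg_add_cancel]
    rw [sub_eq_neg_add]
  have hulh : upperLeft (h : GLBlock n k) = A := by
    rw [upperLeft, hval, Matrix.toBlocks_fromBlocks₁₁]
  have hD : D - C * A⁻¹ * B = antiDiag n k * (A⁻¹)ᵀ * antiDiag n k := by
    have := toBlocks₂₂_eq h.2 (Or.inr (by rw [hval, Matrix.toBlocks_fromBlocks₂₁]))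
    rwa [hulh, hval, Matrix.toBlocks_fromBlocks₂₂] at this
  have hB := mem_symp.1 h.2
  rw [hval, fromBlocks_symp_iff, hD] at hB
  have h5 := hB.2.2
  have hY : (A⁻¹ * B)ᵀ * antiDiag n k = antiDiag n k * (A⁻¹ * B) := by
    have e1 : Bᵀ * antiDiag n k * (antiDiag n k * (A⁻¹)ᵀ * antiDiag n k) =
        (A⁻¹ * B)ᵀ * antiDiag n k := by
      calc _ = Bᵀ * (antiDiag n k * antiDiag n k) * (A⁻¹)ᵀ * antiDiag n k := by
            simp only [Matrix.mul_assoc]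
        _ = _ := by rw [antiDiag_mul_antiDiag, Matrix.mul_one, Matrix.transpose_mul]
    have e2 : (antiDiag n k * (A⁻¹)ᵀ * antiDiag n k)ᵀ * antiDiag n k * B =
        antiDiag n k * (A⁻¹ * B) := by
      calc _ = antiDiag n k * (A⁻¹ * ((antiDiag n k * antiDiag n k) * B)) := by
            simp only [Matrix.mul_assoc, Matrix.transpose_mul, antiDiag_transpose,
              Matrix.transpose_transpose]
        _ = _ := by rw [antiDiag_mul_antiDiag, Matrix.one_mul]
    rw [← e1, ← h5, e2]
  refine ⟨_, _, hX, hY, ?_⟩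
  rw [mul_assoc, ← inv_mul_eq_iff_eq_mul]
  apply Subtype.ext
  apply Units.ext
  change (h : GLBlock n k).val = (leviSymp A hA).1.val * fromBlocks 1 (A⁻¹ * B) 0 1
  rw [hval, hD, leviSymp_val, Matrix.fromBlocks_multiply]
  simp [← Matrix.mul_assoc, hAi]

end Symplectic

/-! ### Regular functions on families of group elements -/

section RegularFunctions

variable {n : ℕ} {k : Type*} [Field k]

/-- A regular function on a closed subgroup of `Sp`, restricted to a family `γ` of elements, lies
in every algebra of functions that contains the matrix entries of the family. The entries of the
inverse come for free, since they are up to sign and order those of the matrix. -/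
theorem regularFunctions_comp_mem {H : Subgroup (GLBlock n k)} (hH : H ≤ symp n k) {Y : Type*}
    (S : Subalgebra k (Y → k)) (γ : Y → H)
    (hγ : ∀ i j, (fun y => (γ y : GLBlock n k).val i j) ∈ S) {F : H → k}
    (hF : F ∈ regularFunctions H) : (fun y => F (γ y)) ∈ S := by
  let τ : (H → k) →ₐ[k] (Y → k) := AlgHom.pi fun y => Pi.evalAlgHom k (fun _ : H => k) (γ y)
  suffices regularFunctions H ≤ S.comap τ from this hF
  rw [regularFunctions, Algebra.adjoin_le_iff]
  rintro _ (⟨⟨i, j⟩, rfl⟩ | ⟨⟨i, j⟩, rfl⟩)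
  · exact hγ i j
  · change (fun y => ((γ y : GLBlock n k)⁻¹ : GLBlock n k).val i j) ∈ S
    have : (fun y => ((γ y : GLBlock n k)⁻¹ : GLBlock n k).val i j) =
        ∑ a, ∑ b, (-(sympForm n k i b * sympForm n k a j)) •
          (fun y => (γ y : GLBlock n k).val a b) := by
      funext y
      rw [val_inv_of_mem_symp (hH (γ y).2)]
      simp only [sympInv, Matrix.neg_apply, Matrix.mul_apply, Matrix.transpose_apply,
        Finset.sum_apply, Pi.smul_apply, smul_eq_mul, Finset.sum_mul, ← Finset.sum_neg_distrib]
      refine Finset.sum_congr rfl fun a _ => Finset.sum_congr rfl fun b _ => by ring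
    rw [this]
    exact S.sum_mem fun a _ => S.sum_mem fun b _ => S.smul_mem (hγ a b) _

theorem entry_mem_regularFunctions (H : Subgroup (GLBlock n k)) (i j : Fin n ⊕ Fin n) :
    (fun h : H => (h : GLBlock n k).val i j) ∈ regularFunctions H :=
  Algebra.subset_adjoin (Or.inl ⟨(i, j), rfl⟩)

theorem inv_entry_mem_regularFunctions (H : Subgroup (GLBlock n k)) (i j : Fin n ⊕ Fin n) :
    (fun h : H => ((h : GLBlock n k)⁻¹ : GLBlock n k).val i j) ∈ regularFunctions H :=
  Algebra.subset_adjoin (Or.inr ⟨(i, j), rfl⟩)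

/-- The functions on `Y` that become polynomials in the coordinates `c` after multiplication by a
power of `q`. -/
def polyFractions {Y σ : Type*} (c : Y → σ → k) (q : MvPolynomial σ k) : Subalgebra k (Y → k) where
  carrier := {h | ∃ (m : ℕ) (R : MvPolynomial σ k),
    ∀ y, MvPolynomial.eval (c y) q ^ m * h y = MvPolynomial.eval (c y) R}
  mul_mem' := by
    rintro h h' ⟨m, R, hR⟩ ⟨m', R', hR'⟩
    refine ⟨m + m', R * R', fun y => ?_⟩
    rw [map_mul, ← hR, ← hR', Pi.mul_apply]
    ring
  add_mem' := by
    rintro h h' ⟨m, R, hR⟩ ⟨m', R', hR'⟩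
    refine ⟨m + m', q ^ m' * R + q ^ m * R', fun y => ?_⟩
    rw [map_add, map_mul, map_mul, ← hR, ← hR', Pi.add_apply, map_pow, map_pow]
    ring
  algebraMap_mem' r := ⟨0, MvPolynomial.C r, fun y => by simp⟩

theorem eval_mem_polyFractions {Y σ : Type*} (c : Y → σ → k) (q f : MvPolynomial σ k) :
    (fun y => MvPolynomial.eval (c y) f) ∈ polyFractions c q :=
  ⟨0, f, fun y => by simp⟩

theorem inv_mem_polyFractions {Y σ : Type*} (c : Y → σ → k) (q : MvPolynomial σ k)
    (hq : ∀ y, MvPolynomial.eval (c y) q ≠ 0) :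
    (fun y => (MvPolynomial.eval (c y) q)⁻¹) ∈ polyFractions c q :=
  ⟨1, 1, fun y => by simp [hq y]⟩

theorem MvPolynomial.eq_of_eval_eq_of_ne_zero [Infinite k] {σ : Type*} {f g q : MvPolynomial σ k}
    (hq : q ≠ 0)
    (h : ∀ x, MvPolynomial.eval x q ≠ 0 → MvPolynomial.eval x f = MvPolynomial.eval x g) :
    f = g := by
  have : q * (f - g) = 0 := by
    apply MvPolynomial.funext
    intro x
    by_cases hx : MvPolynomial.eval x q = 0
    · simp [hx]
    · simp [h x hx]
  exact sub_eq_zero.1 ((mul_eq_zero.1 this).resolve_left hq)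

end RegularFunctions

/-! ### Equivariance of sections under the zip group -/

section Sections

variable {p : ℕ} [Fact p.Prime] {n : ℕ} {k : Type*} [Field k] [CharP k p]

/-- Equivariance of a section under the zip group, evaluated at the identity of `L`: for
`(x, y) ∈ E` one has `f(x⁻¹ g y)(1) = f(g)(x̄)`. The condition `φ(x̄) = ȳ` needs to be checked on
upper left blocks only. -/
theorem zipSections_apply_one {lam : Fin n → ℤ} {f : symp n k → levi n k → k}
    (hf : f ∈ zipSections p n k lam) {x y : symp n k}
    (hx : (x : GLBlock n k).val.toBlocks₁₂ = 0) (hy : (y : GLBlock n k).val.toBlocks₂₁ = 0)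
    (hxy : upperLeft (y : GLBlock n k) = (upperLeft (x : GLBlock n k)).map (frobenius k p))
    (g : symp n k) :
    f (x⁻¹ * g * y) 1 = f g (leviProjP n k ⟨x, mem_parP_of x.2 hx⟩) := by
  set ε : parP n k × parQ n k := (⟨x, mem_parP_of x.2 hx⟩, ⟨y, mem_parQ_of y.2 hy⟩) with hε
  have hmem : ε ∈ zipGroup p n k := by
    change frobGL p n k (leviProjP n k ε.1 : GLBlock n k) = (leviProjQ n k ε.2 : GLBlock n k)
    apply Units.ext
    change (diagPart (x : GLBlock n k).val).map (frobenius k p) = diagPart (y : GLBlock n k).val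
    have hJ : (antiDiag n k).map (frobenius k p) = antiDiag n k := by
      ext i j
      simp only [antiDiag, Matrix.map_apply, Matrix.of_apply]
      split_ifs <;> simp
    have hxu : (upperLeft (x : GLBlock n k))⁻¹ * upperLeft (x : GLBlock n k) = 1 := by
      rw [Matrix.inv_eq_left_inv (upperLeft_inv_mul x.2 (Or.inl hx)),
        upperLeft_inv_mul x.2 (Or.inl hx)]
    have hinv : ((upperLeft (x : GLBlock n k)).map (frobenius k p))⁻¹ =
        ((upperLeft (x : GLBlock n k))⁻¹).map (frobenius k p) := by
      apply Matrix.inv_eq_left_inv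
      rw [← Matrix.map_mul, hxu]
      exact Matrix.map_one _ (map_zero _) (map_one _)
    have h22 : (y : GLBlock n k).val.toBlocks₂₂ =
        (x : GLBlock n k).val.toBlocks₂₂.map (frobenius k p) := by
      rw [toBlocks₂₂_eq x.2 (Or.inl hx), toBlocks₂₂_eq y.2 (Or.inr hy), hxy, hinv,
        Matrix.map_mul, Matrix.map_mul, hJ, Matrix.transpose_map]
    rw [diagPart, diagPart, Matrix.fromBlocks_map, h22]
    change _ = fromBlocks (upperLeft (y : GLBlock n k)) 0 0 _
    rw [hxy]
    simp [upperLeft]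
  have h := congrFun (hf.2 ε hmem (x⁻¹ * g * y)) (leviProjP n k ε.1)
  have hg : zipAct ε (x⁻¹ * g * y) = g := by
    apply Subtype.ext
    change (x : GLBlock n k) * ((x : GLBlock n k)⁻¹ * g * y) * (y : GLBlock n k)⁻¹ = g
    group
  rw [hg, leftTranslate, inv_mul_cancel] at h
  exact h.symm

theorem apply_mem_indRep {lam : Fin n → ℤ} {f : symp n k → levi n k → k}
    (hf : f ∈ regularMaps n k lam) (g : symp n k) : f g ∈ indRep n k lam := by
  induction hf using Submodule.span_induction with
  | mem f hf =>
    obtain ⟨c, _, v, hv, rfl⟩ := hf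
    exact Submodule.smul_mem _ _ hv
  | zero => exact zero_mem _
  | add f f' _ _ h h' => exact add_mem h h'
  | smul c f _ h => exact Submodule.smul_mem _ _ h

theorem apply_one_mem_regularFunctions {lam : Fin n → ℤ} {f : symp n k → levi n k → k}
    (hf : f ∈ regularMaps n k lam) : (fun g => f g 1) ∈ regularFunctions (symp n k) := by
  induction hf using Submodule.span_induction with
  | mem f hf =>
    obtain ⟨c, hc, v, hv, rfl⟩ := hf
    have : (fun g => (c g • v) 1) = v 1 • c := by
      funext g
      simp [mul_comm]
    rw [this]
    exact Subalgebra.smul_mem _ hc _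
  | zero => exact zero_mem _
  | add f f' _ _ h h' => exact add_mem h h'
  | smul c f _ h => exact Subalgebra.smul_mem _ h c

theorem zipSections_apply_one_of_upperLeft_eq_one {lam : Fin n → ℤ}
    {f : symp n k → levi n k → k} (hf : f ∈ zipSections p n k lam) {x y : symp n k}
    (hx : (x : GLBlock n k).val.toBlocks₁₂ = 0) (hy : (y : GLBlock n k).val.toBlocks₂₁ = 0)
    (hx1 : upperLeft (x : GLBlock n k) = 1) (hy1 : upperLeft (y : GLBlock n k) = 1)
    (g : symp n k) : f (x⁻¹ * g * y) 1 = f g 1 := by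
  rw [zipSections_apply_one hf hx hy ?_ g]
  · congr 1
    apply Subtype.ext
    apply Units.ext
    change diagPart (x : GLBlock n k).val = 1
    rw [diagPart, toBlocks₂₂_eq x.2 (Or.inl hx)]
    change fromBlocks (upperLeft (x : GLBlock n k)) 0 0 _ = 1
    rw [hx1, ← Matrix.fromBlocks_one]
    simp [antiDiag_mul_antiDiag]
  · rw [hx1, hy1]
    exact (Matrix.map_one _ (map_zero _) (map_one _)).symm

/-- On the open cell `det A ≠ 0` the function `g ↦ f(g)(1)` depends on the block `A` only, since
it is invariant under `R_u(P) × R_u(Q)`. -/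
theorem zipSections_apply_one_congr {lam : Fin n → ℤ} {f : symp n k → levi n k → k}
    (hf : f ∈ zipSections p n k lam) {g g' : symp n k}
    (hA : IsUnit (upperLeft (g : GLBlock n k)).det)
    (h : upperLeft (g : GLBlock n k) = upperLeft (g' : GLBlock n k)) : f g 1 = f g' 1 := by
  have key : ∀ (g : symp n k) (hA : IsUnit (upperLeft (g : GLBlock n k)).det),
      f g 1 = f (leviSymp _ hA) 1 := by
    intro g hA
    obtain ⟨X, Y, hX, hY, hg⟩ := exists_unip_mul_leviSymp g hA
    have hY' : (-Y)ᵀ * antiDiag n k = antiDiag n k * (-Y) := by simp [hY]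
    have hyinv : sympMk _ (unipUpper_symp hY) * sympMk _ (unipUpper_symp hY') = 1 := by
      apply Subtype.ext
      apply Units.ext
      change fromBlocks 1 Y 0 1 * fromBlocks 1 (-Y) 0 1 = 1
      simp [Matrix.fromBlocks_multiply]
    rw [← zipSections_apply_one_of_upperLeft_eq_one hf (x := sympMk _ (unipLower_symp hX))
      (y := sympMk _ (unipUpper_symp hY')) (by simp) (by simp) (by simp [upperLeft])
      (by simp [upperLeft]) g]
    congr 2
    conv_lhs => rw [hg]
    rw [← mul_assoc, inv_mul_cancel_left, mul_assoc, hyinv, mul_one]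
  rw [key g hA, key g' (h ▸ hA)]
  congr 2

/-- Lower triangularity of an element of `L` needs to be checked on its upper left block only. -/
theorem leviProjP_mem_borelLevi {x : symp n k} (hx : (x : GLBlock n k).val.toBlocks₁₂ = 0)
    (hxl : ∀ i j, i < j → upperLeft (x : GLBlock n k) i j = 0) :
    (leviProjP n k ⟨x, mem_parP_of x.2 hx⟩ : GLBlock n k) ∈ borelLevi n k := by
  set l := leviProjP n k ⟨x, mem_parP_of x.2 hx⟩ with hl
  refine ⟨⟨l.2.1.1, ?_⟩, l.2⟩
  have hinv : ∀ i j, i < j → (upperLeft (x : GLBlock n k))⁻¹ i j = 0 := by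
    have : Invertible (upperLeft (x : GLBlock n k)) :=
      ⟨_, upperLeft_inv_mul x.2 (Or.inl hx), mul_eq_one_comm.1 (upperLeft_inv_mul x.2 (Or.inl hx))⟩
    have h1 : (upperLeft (x : GLBlock n k)).BlockTriangular OrderDual.toDual :=
      fun i j hij => hxl i j hij
    intro i j hij
    exact Matrix.blockTriangular_inv_of_blockTriangular h1 hij
  have hval : (l : GLBlock n k).val = fromBlocks (upperLeft (x : GLBlock n k)) 0 0
      (antiDiag n k * ((upperLeft (x : GLBlock n k))⁻¹)ᵀ * antiDiag n k) := by
    rw [← toBlocks₂₂_eq x.2 (Or.inl hx)]; rfl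
  change (l : GLBlock n k).val.BlockTriangular _
  rw [hval]
  rintro (i | i) (j | j) hij <;> have hij' := OrderDual.toDual_lt_toDual.1 hij
  · exact hxl i j (by simpa using hij')
  · rfl
  · rfl
  · rw [Matrix.fromBlocks_apply₂₂, mul_antiDiag_apply, antiDiag_mul_apply, Matrix.transpose_apply]
    exact hinv _ _ (by simpa using hij')

theorem zipSections_apply_one_of_lower {lam : Fin n → ℤ} {f : symp n k → levi n k → k}
    (hf : f ∈ zipSections p n k lam) {x y : symp n k}
    (hx : (x : GLBlock n k).val.toBlocks₁₂ = 0) (hy : (y : GLBlock n k).val.toBlocks₂₁ = 0)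
    (hxy : upperLeft (y : GLBlock n k) = (upperLeft (x : GLBlock n k)).map (frobenius k p))
    (hxl : ∀ i j, i < j → upperLeft (x : GLBlock n k) i j = 0) (g : symp n k) :
    f (x⁻¹ * g * y) 1 = (∏ i, upperLeft (x : GLBlock n k) i i ^ lam i)⁻¹ * f g 1 := by
  rw [zipSections_apply_one hf hx hy hxy g, ← one_mul (leviProjP n k _),
    (apply_mem_indRep hf.1 g).2 1 _ (leviProjP_mem_borelLevi hx hxl)]
  rfl

/-- A section is determined by its values at the identity of `L`. -/
theorem zipSections_eq_zero_of_apply_one {lam : Fin n → ℤ} {f : symp n k → levi n k → k}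
    (hf : f ∈ zipSections p n k lam) (h : ∀ g, f g 1 = 0) : f = 0 := by
  funext g l
  have hx : (l : GLBlock n k).val.toBlocks₁₂ = 0 := toBlocks₁₂_of_mem_parP l.2.1
  have hx' : (l : GLBlock n k).val.toBlocks₂₁ = 0 := toBlocks₂₁_of_mem_parQ l.2.2
  let x : symp n k := ⟨l, l.2.1.1⟩
  have hdet : IsUnit ((upperLeft (l : GLBlock n k)).map (frobenius k p)).det := by
    have h1 : IsUnit (upperLeft (l : GLBlock n k)).det :=
      (Matrix.isUnit_iff_isUnit_det _).1
        (IsUnit.of_mul_eq_one_right _ (upperLeft_inv_mul x.2 (Or.inl hx)))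
    have h2 := h1.map (frobenius k p)
    rwa [RingHom.map_det] at h2
  have := zipSections_apply_one hf (x := x) (y := leviSymp _ hdet) hx
    (by rw [leviSymp_val, Matrix.toBlocks_fromBlocks₂₁]) (upperLeft_leviSymp _ _) g
  rw [h] at this
  rw [Pi.zero_apply, Pi.zero_apply, this]
  congr 1
  apply Subtype.ext
  apply Units.ext
  change _ = diagPart (l : GLBlock n k).val
  rw [diagPart]
  conv_lhs => rw [← Matrix.fromBlocks_toBlocks (l : GLBlock n k).val, hx, hx']

end Sections

/-! ### Polynomials in the block `A` -/

section Pullback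

variable {n : ℕ} {k : Type*} [Field k]

theorem pullbackA_apply (f : MvPolynomial (Fin n × Fin n) k) (g : symp n k) :
    pullbackA n k f g =
      MvPolynomial.eval (fun ij => upperLeft (g : GLBlock n k) ij.1 ij.2) f := by
  induction f using MvPolynomial.induction_on with
  | C a => simp [pullbackA]
  | add f f' h h' => simp [h, h']
  | mul_X f i h => simp [h]; left; simp [pullbackA, upperLeft, Matrix.toBlocks₁₁]

theorem pullbackA_mem_regularFunctions (f : MvPolynomial (Fin n × Fin n) k) :
    pullbackA n k f ∈ regularFunctions (symp n k) := by
  induction f using MvPolynomial.induction_on with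
  | C a => rw [← MvPolynomial.algebraMap_eq, AlgHom.commutes]; exact Subalgebra.algebraMap_mem _ a
  | add f f' h h' => rw [map_add]; exact add_mem h h'
  | mul_X f i h =>
    rw [map_mul]
    refine mul_mem h ?_
    rw [pullbackA, MvPolynomial.aeval_X]
    exact entry_mem_regularFunctions _ _ _

theorem cornerMinor_self :
    cornerMinor n k n le_rfl = (Matrix.mvPolynomialX (Fin n) (Fin n) k).det := by
  rw [cornerMinor]
  congr 1
  ext i j : 2
  simp [Matrix.mvPolynomialX]

theorem eval_cornerMinor_self (M : Matrix (Fin n) (Fin n) k) :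
    MvPolynomial.eval (fun ij : Fin n × Fin n => M ij.1 ij.2) (cornerMinor n k n le_rfl) =
      M.det := by
  rw [cornerMinor_self, RingHom.map_det]
  congr 1
  exact Matrix.mvPolynomialX_mapMatrix_eval M

theorem cornerMinor_self_ne_zero : cornerMinor n k n le_rfl ≠ 0 := by
  intro h
  have := eval_cornerMinor_self (1 : Matrix (Fin n) (Fin n) k)
  simp [h] at this

theorem pullbackA_injective [Infinite k] : Function.Injective (pullbackA n k) := by
  intro f f' h
  refine MvPolynomial.eq_of_eval_eq_of_ne_zero cornerMinor_self_ne_zero fun x hx => ?_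
  have hx' := eval_cornerMinor_self (Matrix.of fun i j => x (i, j))
  simp only [Matrix.of_apply, Prod.mk.eta] at hx'
  rw [hx'] at hx
  have := congrFun h (leviSymp _ (isUnit_iff_ne_zero.2 hx))
  simpa [pullbackA_apply] using this

/-- A regular function on `G`, restricted to `L ≅ GL_n`, is a polynomial divided by a power of the
determinant. -/
theorem exists_det_pow_mul_leviSymp {F : symp n k → k} (hF : F ∈ regularFunctions (symp n k)) :
    ∃ (N : ℕ) (H : MvPolynomial (Fin n × Fin n) k), ∀ M (hM : IsUnit M.det),
      M.det ^ N * F (leviSymp M hM) = MvPolynomial.eval (fun ij => M ij.1 ij.2) H := by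
  let Y := {M : Matrix (Fin n) (Fin n) k // IsUnit M.det}
  let c : Y → Fin n × Fin n → k := fun M ij => M.1 ij.1 ij.2
  have hq : ∀ y : Y, MvPolynomial.eval (c y) (cornerMinor n k n le_rfl) = y.1.det := fun y =>
    eval_cornerMinor_self y.1
  have hinv : ∀ i j, (fun y : Y => y.1⁻¹ i j) ∈ polyFractions c (cornerMinor n k n le_rfl) := by
    intro i j
    have h1 := inv_mem_polyFractions c (cornerMinor n k n le_rfl)
      (fun y => by rw [hq]; exact y.2.ne_zero)
    have h2 := eval_mem_polyFractions c (cornerMinor n k n le_rfl)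
      ((Matrix.mvPolynomialX (Fin n) (Fin n) k).adjugate i j)
    convert mul_mem h1 h2 using 1
    funext y
    rw [Pi.mul_apply, hq, Matrix.inv_def, Matrix.smul_apply, Ring.inverse_eq_inv', smul_eq_mul]
    congr 1
    have h3 := RingHom.map_adjugate (MvPolynomial.eval (c y))
      (Matrix.mvPolynomialX (Fin n) (Fin n) k)
    have h4 : (MvPolynomial.eval (c y)).mapMatrix (Matrix.mvPolynomialX (Fin n) (Fin n) k) = y.1 :=
      Matrix.mvPolynomialX_mapMatrix_eval y.1
    rw [h4] at h3
    rw [← h3]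
    rfl
  obtain ⟨N, H, hH⟩ := regularFunctions_comp_mem le_rfl
    (polyFractions c (cornerMinor n k n le_rfl)) (fun y => leviSymp y.1 y.2) (by
      rintro (i | i) (j | j)
      · exact ⟨0, MvPolynomial.X (i, j), fun y => by simp [leviSymp_val, c]⟩
      · exact zero_mem _
      · exact zero_mem _
      · convert hinv (Fin.rev j) (Fin.rev i) using 1
        funext y
        rw [leviSymp_val, Matrix.fromBlocks_apply₂₂, mul_antiDiag_apply, antiDiag_mul_apply,
          Matrix.transpose_apply]) hF
  refine ⟨N, H, fun M hM => ?_⟩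
  rw [← hH ⟨M, hM⟩, hq]

end Pullback

theorem MvPolynomial.X_dvd_of_eval_eq_zero {k σ : Type*} [Field k] [Infinite k] (i : σ)
    {R : MvPolynomial σ k} (h : ∀ x, x i = 0 → MvPolynomial.eval x R = 0) :
    MvPolynomial.X i ∣ R := by
  classical
  let e : MvPolynomial σ k →ₐ[k] MvPolynomial σ k :=
    MvPolynomial.aeval (Function.update MvPolynomial.X i 0)
  have h1 : ∀ f : MvPolynomial σ k, MvPolynomial.X i ∣ f - e f := by
    intro f
    induction f using MvPolynomial.induction_on with
    | C a => simp [e, MvPolynomial.algebraMap_eq]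
    | add f f' h h' => rw [map_add, add_sub_add_comm]; exact dvd_add h h'
    | mul_X f j h =>
      have : f * MvPolynomial.X j - e (f * MvPolynomial.X j) =
          (f - e f) * MvPolynomial.X j + e f * (MvPolynomial.X j - e (MvPolynomial.X j)) := by
        rw [map_mul]; ring
      rw [this]
      refine dvd_add (Dvd.dvd.mul_right h _) (Dvd.dvd.mul_left ?_ _)
      by_cases hj : j = i
      · subst hj; simp [e]
      · simp [e, hj]
  have h2 : e R = 0 := by
    apply MvPolynomial.funext
    intro x
    have h3 : MvPolynomial.eval x (e R) = MvPolynomial.eval (Function.update x i 0) R := by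
      simp only [e]
      rw [MvPolynomial.aeval_def, MvPolynomial.eval_eval₂]
      rw [MvPolynomial.eval, MvPolynomial.eval, MvPolynomial.coe_eval₂Hom,
        MvPolynomial.coe_eval₂Hom]
      congr 1
      · ext; simp
      · funext j
        by_cases hj : j = i
        · subst hj; simp
        · simp [hj]
    rw [h3, map_zero]
    exact h _ (by simp)
  simpa [h2] using h1 R

/-! ### The subring generated by `α`, `Δ_1`, `Δ_2` -/

section Invariants

variable (p : ℕ) (k : Type*) [Field k]

/-- The three generators `α`, `Δ_1`, `Δ_2`. -/
noncomputable def zipGens : Fin 3 → MvPolynomial (Fin 2 × Fin 2) k :=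
  ![alphaPoly p k, cornerMinor 2 k 1 (by norm_num), cornerMinor 2 k 2 le_rfl]

variable {k}

theorem range_zipGens : Set.range (zipGens p k) =
    {alphaPoly p k, cornerMinor 2 k 1 (by norm_num), cornerMinor 2 k 2 le_rfl} := by
  rw [zipGens, Matrix.range_cons, Matrix.range_cons, Matrix.range_cons, Matrix.range_empty,
    Set.union_empty]
  rfl

theorem cornerMinor_two_one : cornerMinor 2 k 1 (by norm_num) = MvPolynomial.X (0, 1) := by
  rw [cornerMinor, Matrix.det_fin_one]
  simp [Matrix.mvPolynomialX]

variable {p} in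
theorem eval_alphaPoly (x : Fin 2 × Fin 2 → k) : MvPolynomial.eval x (alphaPoly p k) =
    x (0, 0) * x (0, 1) ^ (p - 1) + x (1, 1) ^ p := by
  simp [alphaPoly, cornerMinor_two_one]

theorem eval_cornerMinor_two_two (x : Fin 2 × Fin 2 → k) :
    MvPolynomial.eval x (cornerMinor 2 k 2 le_rfl) = x (0, 0) * x (1, 1) - x (0, 1) * x (1, 0) := by
  have := eval_cornerMinor_self (Matrix.of fun i j => x (i, j))
  simp only [Matrix.of_apply, Prod.mk.eta] at this
  rw [this, Matrix.det_fin_two]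
  rfl

theorem eval_aeval_zipGens (x : Fin 2 × Fin 2 → k) (R : MvPolynomial (Fin 3) k) :
    MvPolynomial.eval x (MvPolynomial.aeval (zipGens p k) R) =
      MvPolynomial.eval ![x (0, 0) * x (0, 1) ^ (p - 1) + x (1, 1) ^ p, x (0, 1),
        x (0, 0) * x (1, 1) - x (0, 1) * x (1, 0)] R := by
  rw [MvPolynomial.aeval_def, MvPolynomial.eval_eval₂, MvPolynomial.eval, MvPolynomial.eval,
    MvPolynomial.coe_eval₂Hom, MvPolynomial.coe_eval₂Hom]
  congr 1
  · ext; simp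
  · funext i
    change MvPolynomial.eval x (zipGens p k i) = _
    fin_cases i
    · exact eval_alphaPoly x
    · change MvPolynomial.eval x (cornerMinor 2 k 1 (by norm_num)) = x (0, 1)
      rw [cornerMinor_two_one, MvPolynomial.eval_X]
    · exact eval_cornerMinor_two_two x

/-- The matrix `(x / b^{p-1}, b; -δ / b, 0)`, at which `α`, `Δ_1`, `Δ_2` take the values
`x`, `b`, `δ`. -/
def sliceMatrix (x b δ : k) : Matrix (Fin 2) (Fin 2) k := !![x / b ^ (p - 1), b; -δ / b, 0]

theorem zipGens_algebraicIndependent [Infinite k] (hp : p ≠ 0) :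
    AlgebraicIndependent k (zipGens p k) := by
  rw [algebraicIndependent_iff]
  intro R hR
  refine MvPolynomial.eq_of_eval_eq_of_ne_zero (MvPolynomial.X_ne_zero (1 : Fin 3)) fun v hv => ?_
  rw [MvPolynomial.eval_X] at hv
  have h := eval_aeval_zipGens p (fun ij => sliceMatrix p (v 0) (v 1) (v 2) ij.1 ij.2) R
  rw [hR] at h
  rw [map_zero] at h ⊢
  rw [h]
  congr 2
  funext i
  fin_cases i <;> simp [sliceMatrix, hv, hp, mul_div_cancel₀]

/-- If `Δ_1` divides `Δ_2^N R(α, Δ_1, Δ_2)`, then the second variable divides `R`: modulo `Δ_1` the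
elements `α = d^p` and `Δ_2 = a d` remain algebraically independent. -/
theorem X_one_dvd_of_dvd [IsAlgClosed k] (hp : p ≠ 0) (hp1 : p ≠ 1) (N : ℕ)
    (R : MvPolynomial (Fin 3) k)
    (h : MvPolynomial.X (0, 1) ∣
      cornerMinor 2 k 2 le_rfl ^ N * MvPolynomial.aeval (zipGens p k) R) :
    MvPolynomial.X 1 ∣ R := by
  have : Infinite k := IsAlgClosed.instInfinite
  have hdvd : MvPolynomial.X (1 : Fin 3) ∣ MvPolynomial.X 0 * MvPolynomial.X 2 * R := by
    refine MvPolynomial.X_dvd_of_eval_eq_zero 1 fun v hv => ?_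
    by_cases h0 : v 0 = 0
    · simp [h0]
    by_cases h2 : v 2 = 0
    · simp [h2]
    obtain ⟨d, hd⟩ := IsAlgClosed.exists_pow_nat_eq (v 0) (Nat.pos_of_ne_zero hp)
    have hd0 : d ≠ 0 := by
      rintro rfl
      rw [zero_pow hp] at hd
      exact h0 hd.symm
    obtain ⟨Q, hQ⟩ := h
    have hx := congrArg (MvPolynomial.eval
      (fun ij => (!![v 2 / d, 0; 0, d] : Matrix (Fin 2) (Fin 2) k) ij.1 ij.2)) hQ
    rw [map_mul, map_pow, map_mul, eval_aeval_zipGens, eval_cornerMinor_two_two,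
      MvPolynomial.eval_X] at hx
    have hv' : v = ![v 0, 0, v 2] := by
      funext i
      fin_cases i <;> simp [hv]
    have hx' : v 2 ^ N * MvPolynomial.eval v R = 0 := by
      rw [hv']
      simpa [hd, hd0, Nat.sub_ne_zero_of_lt (lt_of_le_of_ne (Nat.pos_of_ne_zero hp) hp1.symm)]
        using hx
    rw [map_mul, (mul_eq_zero.1 hx').resolve_left (pow_ne_zero _ h2), mul_zero]
  have hprime : Prime (MvPolynomial.X (1 : Fin 3) : MvPolynomial (Fin 3) k) :=
    MvPolynomial.X_prime
  rcases hprime.dvd_or_dvd hdvd with h' | h'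
  · rcases hprime.dvd_or_dvd h' with h' | h' <;> simp [MvPolynomial.X_dvd_X] at h'
  · exact h'

/-- Denominators in `Δ_1` can be removed from an identity between a polynomial and an element of
`k[α, Δ_1, Δ_2]`. -/
theorem exists_eq_of_X_pow_mul_eq [IsAlgClosed k] (hp : p ≠ 0) (hp1 : p ≠ 1) (N m : ℕ)
    (H : MvPolynomial (Fin 2 × Fin 2) k) (R : MvPolynomial (Fin 3) k)
    (h : MvPolynomial.X (0, 1) ^ m * H =
      cornerMinor 2 k 2 le_rfl ^ N * MvPolynomial.aeval (zipGens p k) R) :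
    ∃ R' : MvPolynomial (Fin 3) k,
      H = cornerMinor 2 k 2 le_rfl ^ N * MvPolynomial.aeval (zipGens p k) R' := by
  induction m generalizing R with
  | zero => exact ⟨R, by rw [← h, pow_zero, one_mul]⟩
  | succ m ih =>
    obtain ⟨R₁, rfl⟩ := X_one_dvd_of_dvd p hp hp1 N R ⟨_, by rw [← h, pow_succ', mul_assoc]⟩
    refine ih R₁ (mul_left_cancel₀ (MvPolynomial.X_ne_zero (0, 1)) ?_)
    rw [← mul_assoc, ← pow_succ', h, map_mul, MvPolynomial.aeval_X]
    have : zipGens p k 1 = MvPolynomial.X (0, 1) := cornerMinor_two_one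
    rw [this]
    ring

end Invariants

/-! ### Sections on the open cell -/

section OpenCell

variable {k : Type*} [Field k]

/-- An element of `G` with upper left block `sliceMatrix p x b δ` whose entries are polynomial in
`δ`, so that the family extends over the divisor `Δ_2 = 0`. -/
def sliceElement (p : ℕ) (x b δ : k) (hb : b ≠ 0) : symp 2 k :=
  sympMk (fromBlocks (sliceMatrix p x b δ) !![0, 0; -(x / b ^ (p - 1)), b] !![-b⁻¹, 0; 0, 0]
    !![0, 0; b⁻¹, 0]) (by
    rw [fromBlocks_symp_iff]
    refine ⟨⟨?_, ?_⟩, ?_, ?_⟩ <;> ext i j <;> fin_cases i <;> fin_cases j <;>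
      simp [sliceMatrix, antiDiag, Matrix.mul_apply, Fin.sum_univ_two, hb] <;> ring)

theorem upperLeft_sliceElement (p : ℕ) (x b δ : k) (hb : b ≠ 0) :
    upperLeft (sliceElement p x b δ hb : GLBlock 2 k) = sliceMatrix p x b δ := by
  rw [upperLeft, sliceElement, sympMk_val, Matrix.toBlocks_fromBlocks₁₁]

theorem exists_pow_mul_sliceElement (p : ℕ) {F : symp 2 k → k}
    (hF : F ∈ regularFunctions (symp 2 k)) :
    ∃ (m : ℕ) (R : MvPolynomial (Fin 3) k), ∀ x b δ (hb : b ≠ 0),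
      b ^ m * F (sliceElement p x b δ hb) = MvPolynomial.eval ![x, b, δ] R := by
  let Y := {v : Fin 3 → k // v 1 ≠ 0}
  let c : Y → Fin 3 → k := Subtype.val
  let S := polyFractions c (MvPolynomial.X 1)
  have hcoord : ∀ i, (fun y : Y => y.1 i) ∈ S := fun i =>
    ⟨0, MvPolynomial.X i, fun y => by simp [c]⟩
  have hinv : (fun y : Y => (y.1 1)⁻¹) ∈ S := ⟨1, 1, fun y => by simp [c, y.2]⟩
  have hquot : (fun y : Y => y.1 0 / y.1 1 ^ (p - 1)) ∈ S := by
    convert mul_mem (hcoord 0) (pow_mem hinv (p - 1)) using 1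
    funext y
    simp [div_eq_mul_inv]
  obtain ⟨m, R, hR⟩ := regularFunctions_comp_mem le_rfl S
    (fun y => sliceElement p (y.1 0) (y.1 1) (y.1 2) y.2) (by
      rintro (i | i) (j | j) <;> fin_cases i <;> fin_cases j
      · exact hquot
      · exact hcoord 1
      · change (fun y : Y => -y.1 2 / y.1 1) ∈ S
        convert neg_mem (mul_mem (hcoord 2) hinv) using 1
        funext y
        simp [div_eq_mul_inv]
      · exact zero_mem S
      · exact zero_mem S
      · exact zero_mem S
      · exact neg_mem hquot
      · exact hcoord 1
      · exact neg_mem hinv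
      · exact zero_mem S
      · exact zero_mem S
      · exact zero_mem S
      · exact zero_mem S
      · exact zero_mem S
      · exact hinv
      · exact zero_mem S) hF
  refine ⟨m, R, fun x b δ hb => ?_⟩
  simpa [c] using hR ⟨![x, b, δ], hb⟩

variable {p : ℕ} [Fact p.Prime] [CharP k p]

/-- On the open set `Δ_1 Δ_2 ≠ 0`, acting by the unipotent radical of `B_L` brings the block `A`
into the form `sliceMatrix`, with the same `α`, `Δ_1`, `Δ_2`. -/
theorem zipSections_apply_leviSymp {lam : Fin 2 → ℤ} {f : symp 2 k → levi 2 k → k}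
    (hf : f ∈ zipSections p 2 k lam) (M : Matrix (Fin 2) (Fin 2) k) (hM : IsUnit M.det)
    (hb : M 0 1 ≠ 0) :
    f (leviSymp M hM) 1 =
      f (sliceElement p (M 0 0 * M 0 1 ^ (p - 1) + M 1 1 ^ p) (M 0 1) M.det hb) 1 := by
  have hp : p ≠ 0 := (Fact.out : p.Prime).ne_zero
  -- the entry `u` is chosen so that the lower right entry of `A` becomes zero
  let u := M 1 1 / M 0 1
  let U : Matrix (Fin 2) (Fin 2) k := !![1, 0; u, 1]
  have hU : U.det = 1 := by simp [U, Matrix.det_fin_two]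
  have hUφ : (U.map (frobenius k p)).det = 1 := by
    simp [U, Matrix.det_fin_two, frobenius_def, hp]
  let x := leviSymp U (by rw [hU]; exact isUnit_one)
  let y := leviSymp (U.map (frobenius k p)) (by rw [hUφ]; exact isUnit_one)
  have hx : (x : GLBlock 2 k).val.toBlocks₁₂ = 0 := Matrix.toBlocks_fromBlocks₁₂ _ _ _ _
  have hy : (y : GLBlock 2 k).val.toBlocks₂₁ = 0 := Matrix.toBlocks_fromBlocks₂₁ _ _ _ _
  have h1 := zipSections_apply_one_of_lower hf hx hy (by simp [x, y])
    (by
      intro i j hij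
      fin_cases i <;> fin_cases j <;> simp [x, U] at hij ⊢) (leviSymp M hM)
  have h2 : (∏ i, upperLeft (x : GLBlock 2 k) i i ^ lam i) = 1 := by
    simp [x, U, Fin.prod_univ_two]
  rw [h2, inv_one, one_mul] at h1
  have hxi : upperLeft (x⁻¹ : GLBlock 2 k) = !![1, 0; -u, 1] := by
    have e1 := upperLeft_inv_mul x.2 (Or.inl hx)
    have e2 : U * !![1, 0; -u, 1] = 1 := by
      ext i j
      fin_cases i <;> fin_cases j <;> simp [U]
    rw [upperLeft_leviSymp] at e1
    exact left_inv_eq_right_inv e1 e2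
  have hul : upperLeft ((x⁻¹ * leviSymp M hM * y : symp 2 k) : GLBlock 2 k) =
      sliceMatrix p (M 0 0 * M 0 1 ^ (p - 1) + M 1 1 ^ p) (M 0 1) M.det := by
    change upperLeft ((x⁻¹ : GLBlock 2 k) * (leviSymp M hM : GLBlock 2 k) * (y : GLBlock 2 k)) = _
    rw [upperLeft_mul_of_right hy, upperLeft_mul_of_left (toBlocks₁₂_inv x.2 hx), hxi,
      upperLeft_leviSymp, upperLeft_leviSymp]
    have hpow : M 0 1 ^ p = M 0 1 * M 0 1 ^ (p - 1) := (mul_pow_sub_one hp _).symm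
    have hUm : U.map (frobenius k p) = !![1, 0; u ^ p, 1] := by
      ext i j
      fin_cases i <;> fin_cases j <;> simp [U, frobenius_def, hp]
    rw [hUm, Matrix.det_fin_two M]
    nth_rewrite 1 [Matrix.eta_fin_two M]
    rw [Matrix.mul_fin_two, Matrix.mul_fin_two, sliceMatrix]
    ext i j
    fin_cases i <;> fin_cases j <;> simp [u, div_pow, hpow] <;> field_simp <;> ring
  rw [← h1]
  apply zipSections_apply_one_congr hf
  · rw [hul]
    have : (sliceMatrix p (M 0 0 * M 0 1 ^ (p - 1) + M 1 1 ^ p) (M 0 1) M.det).det = M.det := by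
      rw [Matrix.det_fin_two (sliceMatrix _ _ _ _)]
      simp only [sliceMatrix, Matrix.of_apply, Matrix.cons_val', Matrix.cons_val_zero,
        Matrix.cons_val_one, Matrix.cons_val_fin_one]
      field_simp
      ring
    rwa [this]
  · rw [hul, upperLeft_sliceElement]

theorem exists_zipGens_of_isUnit_det [IsAlgClosed k] {lam : Fin 2 → ℤ}
    {f : symp 2 k → levi 2 k → k} (hf : f ∈ zipSections p 2 k lam) :
    ∃ R : MvPolynomial (Fin 3) k, ∀ g : symp 2 k, IsUnit (upperLeft (g : GLBlock 2 k)).det →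
      f g 1 = pullbackA 2 k (MvPolynomial.aeval (zipGens p k) R) g := by
  have hp : p.Prime := Fact.out
  have : Infinite k := IsAlgClosed.instInfinite
  have hreg := apply_one_mem_regularFunctions hf.1
  obtain ⟨N, H, hH⟩ := exists_det_pow_mul_leviSymp hreg
  obtain ⟨m, R, hR⟩ := exists_pow_mul_sliceElement p hreg
  have hid : MvPolynomial.X (0, 1) ^ m * H =
      cornerMinor 2 k 2 le_rfl ^ N * MvPolynomial.aeval (zipGens p k) R := by
    refine MvPolynomial.eq_of_eval_eq_of_ne_zero
      (mul_ne_zero cornerMinor_self_ne_zero (MvPolynomial.X_ne_zero (0, 1))) fun x hx => ?_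
    rw [map_mul, MvPolynomial.eval_X, mul_ne_zero_iff] at hx
    obtain ⟨hx1, hb⟩ := hx
    let M : Matrix (Fin 2) (Fin 2) k := Matrix.of fun i j => x (i, j)
    have hdet : MvPolynomial.eval x (cornerMinor 2 k 2 le_rfl) = M.det := eval_cornerMinor_self M
    have hM : IsUnit M.det := isUnit_iff_ne_zero.2 (hdet ▸ hx1)
    have e1 : M.det ^ N * f (leviSymp M hM) 1 = MvPolynomial.eval x H := hH M hM
    have e2 := hR (M 0 0 * M 0 1 ^ (p - 1) + M 1 1 ^ p) (M 0 1) M.det hb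
    rw [← zipSections_apply_leviSymp hf M hM hb] at e2
    have e3 : MvPolynomial.eval x (MvPolynomial.aeval (zipGens p k) R) =
        MvPolynomial.eval ![M 0 0 * M 0 1 ^ (p - 1) + M 1 1 ^ p, M 0 1, M.det] R := by
      rw [eval_aeval_zipGens, Matrix.det_fin_two]
      rfl
    rw [map_mul, map_mul, map_pow, map_pow, MvPolynomial.eval_X, hdet, ← e1, e3, ← e2]
    change M 0 1 ^ m * _ = _
    ring
  obtain ⟨R', hR'⟩ := exists_eq_of_X_pow_mul_eq p hp.ne_zero hp.ne_one N m H R hid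
  refine ⟨R', fun g hg => ?_⟩
  rw [zipSections_apply_one_congr hf (g' := leviSymp _ hg) hg (by simp), pullbackA_apply]
  have e1 := hH _ hg
  rw [hR', map_mul, map_pow, eval_cornerMinor_self] at e1
  exact mul_left_cancel₀ (pow_ne_zero _ hg.ne_zero) e1

end OpenCell

/-! ### Extension from the open cell to the whole group -/

section Density

variable {k : Type*} [Field k]

/-- Each coset `g R_u(P)` meets the open cell `det A ≠ 0`: for `g = (A, B; C, D)` the upper left
block of `g · (1, 0; S, 1)` is `A + B S`, and some `S` symmetric about the antidiagonal makes it
invertible. Otherwise all `2 × 2` minors of `(A, B)` would vanish, so that the first two rows of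
`g` would be linearly dependent. -/
theorem exists_isUnit_det_add_mul (g : symp 2 k) :
    ∃ S : Matrix (Fin 2) (Fin 2) k, Sᵀ * antiDiag 2 k = antiDiag 2 k * S ∧
      IsUnit (upperLeft (g : GLBlock 2 k) + (g : GLBlock 2 k).val.toBlocks₁₂ * S).det := by
  by_contra hcon
  push Not at hcon
  obtain ⟨g, hg⟩ := g
  have hinv : g.val * sympInv g.val = 1 := mul_eq_one_comm.1 (sympInv_mul hg)
  have hrow := hinv
  have hrel : upperLeft g * antiDiag 2 k * g.val.toBlocks₁₂ᵀ =
      g.val.toBlocks₁₂ * antiDiag 2 k * (upperLeft g)ᵀ := by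
    rw [← Matrix.fromBlocks_toBlocks g.val, sympInv_fromBlocks, Matrix.fromBlocks_multiply,
      ← Matrix.fromBlocks_one, Matrix.fromBlocks_inj] at hinv
    have h12 := congrArg (· * antiDiag 2 k) hinv.2.1
    simp only [Matrix.add_mul, Matrix.mul_neg, Matrix.neg_mul, Matrix.mul_assoc,
      antiDiag_mul_antiDiag, Matrix.mul_one, Matrix.zero_mul] at h12
    rw [neg_add_eq_zero] at h12
    simpa only [upperLeft, Matrix.mul_assoc] using h12
  set A := upperLeft g with hA
  set B := g.val.toBlocks₁₂ with hB
  have hdet : ∀ s₁ s₂ s₃ : k, (A + B * !![s₁, s₂; s₃, s₁]).det = 0 := by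
    intro s₁ s₂ s₃
    by_contra h
    refine hcon !![s₁, s₂; s₃, s₁] ?_ (isUnit_iff_ne_zero.2 h)
    ext i j
    fin_cases i <;> fin_cases j <;> simp [antiDiag, Matrix.mul_apply, Fin.sum_univ_two]
  have hr := congrFun (congrFun hrel 0) 1
  have d0 := hdet 0 0 0
  have d2 := hdet 0 1 0
  have d3 := hdet 0 0 1
  have d4 := hdet 0 1 1
  simp [Matrix.det_fin_two, Matrix.mul_apply, Fin.sum_univ_two, antiDiag] at hr d0 d2 d3 d4
  have m12 : A 0 0 * B 1 0 - A 1 0 * B 0 0 = 0 := by linear_combination d2 - d0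
  have m34 : A 0 1 * B 1 1 - A 1 1 * B 0 1 = 0 := by linear_combination d0 - d3
  have mB : B 0 0 * B 1 1 - B 0 1 * B 1 0 = 0 := by
    linear_combination d2 + d3 - d0 - d4
  have mm : A 0 0 * B 1 1 - A 1 0 * B 0 1 = B 0 0 * A 1 1 - A 0 1 * B 1 0 := by
    linear_combination hr
  -- the symplectic relation `mm` makes two minors equal, and the Plücker relation expresses their
  -- product through the minors already known to vanish; this works in characteristic two as well
  have msq : (A 0 0 * B 1 1 - A 1 0 * B 0 1) ^ 2 = 0 := by
    linear_combination (A 0 0 * B 1 1 - A 1 0 * B 0 1) * mm +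
      (B 0 0 * B 1 1 - B 0 1 * B 1 0) * d0 - (A 0 1 * B 1 1 - A 1 1 * B 0 1) * m12
  have m14 := pow_eq_zero_iff (two_ne_zero) |>.1 msq
  have m23 := mm.symm.trans m14
  have hrows : ∀ i j, g.val (Sum.inl 0) i * g.val (Sum.inl 1) j =
      g.val (Sum.inl 0) j * g.val (Sum.inl 1) i := by
    have hAe : ∀ i j, g.val (Sum.inl i) (Sum.inl j) = A i j := fun _ _ => rfl
    have hBe : ∀ i j, g.val (Sum.inl i) (Sum.inr j) = B i j := fun _ _ => rfl
    rintro (i | i) (j | j) <;> fin_cases i <;> fin_cases j <;> simp only [hAe, hBe] <;>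
      simp only [Fin.zero_eta, Fin.mk_one, Fin.isValue] <;>
      first
        | ring1
        | linear_combination d0
        | linear_combination -d0
        | linear_combination mB
        | linear_combination -mB
        | linear_combination m12
        | linear_combination -m12
        | linear_combination m34
        | linear_combination -m34
        | linear_combination m14
        | linear_combination -m14
        | linear_combination m23
        | linear_combination -m23
  have h10 := congrFun (congrFun hrow (Sum.inl 0)) (Sum.inl 1)
  have h11 := congrFun (congrFun hrow (Sum.inl 1)) (Sum.inl 1)
  have h00 := congrFun (congrFun hrow (Sum.inl 0)) (Sum.inl 0)
  rw [Matrix.mul_apply] at h10 h11 h00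
  rw [Matrix.one_apply_eq] at h11 h00
  rw [Matrix.one_apply_ne (by simp)] at h10
  have hzero : ∀ j, g.val (Sum.inl 0) j = 0 := by
    intro j
    calc g.val (Sum.inl 0) j
        = ∑ m, g.val (Sum.inl 0) j * (g.val (Sum.inl 1) m * sympInv g.val m (Sum.inl 1)) := by
          rw [← Finset.mul_sum, h11, mul_one]
      _ = ∑ m, g.val (Sum.inl 1) j * (g.val (Sum.inl 0) m * sympInv g.val m (Sum.inl 1)) := by
          refine Finset.sum_congr rfl fun m _ => ?_
          linear_combination sympInv g.val m (Sum.inl 1) * hrows j m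
      _ = 0 := by rw [← Finset.mul_sum, h10, mul_zero]
  simp [hzero] at h00

/-- The open cell `det A ≠ 0` is dense in `G`. -/
theorem eq_of_eq_on_isUnit_det [Infinite k] {F F' : symp 2 k → k}
    (hF : F ∈ regularFunctions (symp 2 k)) (hF' : F' ∈ regularFunctions (symp 2 k))
    (h : ∀ g : symp 2 k, IsUnit (upperLeft (g : GLBlock 2 k)).det → F g = F' g) : F = F' := by
  funext g
  obtain ⟨S, hS, hdet⟩ := exists_isUnit_det_add_mul g
  have htS : ∀ t : k, (t • S)ᵀ * antiDiag 2 k = antiDiag 2 k * (t • S) := by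
    intro t
    rw [Matrix.transpose_smul, Matrix.smul_mul, hS, Matrix.mul_smul]
  -- a curve through `g` whose generic point lies in the open cell
  let γ : k → symp 2 k := fun t => g * sympMk _ (unipLower_symp (htS t))
  let c : k → Unit → k := fun t _ => t
  have hreg : ∀ {F : symp 2 k → k}, F ∈ regularFunctions (symp 2 k) →
      ∃ R : MvPolynomial Unit k, ∀ t, F (γ t) = MvPolynomial.eval (c t) R := by
    intro F hF
    obtain ⟨m, R, hR⟩ := regularFunctions_comp_mem le_rfl (polyFractions c 1) γ (by
      intro i j
      have : (fun t => (γ t : GLBlock 2 k).val i j) =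
          ∑ l, fun t => (g : GLBlock 2 k).val i l * fromBlocks 1 0 (t • S) 1 l j := by
        funext t
        rw [Finset.sum_apply]
        exact Matrix.mul_apply (M := (g : GLBlock 2 k).val) (N := fromBlocks 1 0 (t • S) 1)
      rw [this]
      refine Subalgebra.sum_mem _ fun l _ => Subalgebra.smul_mem _
        (x := fun t : k => fromBlocks 1 0 (t • S) 1 l j) ?_ _
      rcases l with l | l <;> rcases j with j | j
      · exact Subalgebra.algebraMap_mem _ ((1 : Matrix (Fin 2) (Fin 2) k) l j)
      · exact zero_mem _
      · exact ⟨0, MvPolynomial.X () * MvPolynomial.C (S l j), fun t => by simp [c]⟩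
      · exact Subalgebra.algebraMap_mem _ ((1 : Matrix (Fin 2) (Fin 2) k) l j)) hF
    exact ⟨R, fun t => by simpa using hR t⟩
  obtain ⟨R, hR⟩ := hreg hF
  obtain ⟨R', hR'⟩ := hreg hF'
  obtain ⟨D, hD⟩ := hreg (pullbackA_mem_regularFunctions (cornerMinor 2 k 2 le_rfl))
  have hD' : ∀ t, MvPolynomial.eval (c t) D = (upperLeft (γ t : GLBlock 2 k)).det := fun t => by
    rw [← hD, pullbackA_apply, eval_cornerMinor_self]
  have hul : upperLeft (γ 1 : GLBlock 2 k) =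
      upperLeft (g : GLBlock 2 k) + (g : GLBlock 2 k).val.toBlocks₁₂ * S := by
    change ((g : GLBlock 2 k).val * fromBlocks 1 0 ((1 : k) • S) 1).toBlocks₁₁ = _
    conv_lhs => rw [← Matrix.fromBlocks_toBlocks (g : GLBlock 2 k).val]
    rw [Matrix.fromBlocks_multiply, Matrix.toBlocks_fromBlocks₁₁, one_smul, Matrix.mul_one]
    rfl
  have hD0 : D ≠ 0 := by
    rintro rfl
    have := hD' 1
    rw [map_zero, hul] at this
    exact hdet.ne_zero this.symm
  have hRR : R = R' := by
    refine MvPolynomial.eq_of_eval_eq_of_ne_zero hD0 fun x hx => ?_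
    have hxc : x = c (x ()) := rfl
    rw [hxc, hD'] at hx
    rw [hxc, ← hR, ← hR']
    exact h _ (isUnit_iff_ne_zero.2 hx)
  have hγ : γ 0 = g := by
    apply Subtype.ext
    apply Units.ext
    change (g : GLBlock 2 k).val * fromBlocks 1 0 ((0 : k) • S) 1 = (g : GLBlock 2 k).val
    rw [zero_smul, Matrix.fromBlocks_one, Matrix.mul_one]
  rw [← hγ, hR, hR', hRR]

theorem exists_zipGens_of_mem_zipSections [IsAlgClosed k] {p : ℕ} [Fact p.Prime] [CharP k p]
    {lam : Fin 2 → ℤ} {f : symp 2 k → levi 2 k → k} (hf : f ∈ zipSections p 2 k lam) :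
    ∃ R : MvPolynomial (Fin 3) k,
      (fun g => f g 1) = pullbackA 2 k (MvPolynomial.aeval (zipGens p k) R) := by
  have : Infinite k := IsAlgClosed.instInfinite
  obtain ⟨R, hR⟩ := exists_zipGens_of_isUnit_det hf
  exact ⟨R, eq_of_eq_on_isUnit_det (apply_one_mem_regularFunctions hf.1)
    (pullbackA_mem_regularFunctions _) hR⟩

end Density

/-! ### Construction of sections from equivariant polynomials -/

section Construction

variable {n : ℕ} {k : Type*} [Field k]

/-- The functions on `G × L` of the form `∑ c_i ⊗ v_i` with `c_i` regular on `G` and `v_i` regular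
on `L`, that is, `k[G] ⊗ k[L]`, in curried form. -/
def regularPairs (n : ℕ) (k : Type*) [Field k] : Subalgebra k (symp n k → levi n k → k) :=
  (Submodule.span k {f : symp n k → levi n k → k | ∃ c ∈ regularFunctions (symp n k),
    ∃ v ∈ regularFunctions (levi n k), f = fun g => c g • v}).toSubalgebra
    (Submodule.subset_span ⟨1, one_mem _, 1, one_mem _, by
      funext g l
      simp⟩)
    (by
      intro f f' hf hf'
      have h := Submodule.mul_mem_mul hf hf'
      rw [Submodule.span_mul_span] at h
      refine Submodule.span_mono ?_ h
      rintro _ ⟨_, ⟨c, hc, v, hv, rfl⟩, _, ⟨c', hc', v', hv', rfl⟩, rfl⟩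
      refine ⟨c * c', mul_mem hc hc', v * v', mul_mem hv hv', ?_⟩
      funext g x
      simp only [Pi.mul_apply, Pi.smul_apply, smul_eq_mul]
      ring)

theorem left_mem_regularPairs {c : symp n k → k} (hc : c ∈ regularFunctions (symp n k)) :
    (fun g _ => c g) ∈ regularPairs n k :=
  Submodule.subset_span ⟨c, hc, 1, one_mem _, by
    funext g l
    simp⟩

theorem right_mem_regularPairs {v : levi n k → k} (hv : v ∈ regularFunctions (levi n k)) :
    (fun _ l => v l) ∈ regularPairs n k :=
  Submodule.subset_span ⟨1, one_mem _, v, hv, by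
    funext g l
    simp⟩

theorem apply_mem_of_mem_regularPairs {f : symp n k → levi n k → k} (hf : f ∈ regularPairs n k)
    (g : symp n k) : f g ∈ regularFunctions (levi n k) := by
  induction hf using Submodule.span_induction with
  | mem f hf =>
    obtain ⟨c, _, v, hv, rfl⟩ := hf
    exact Subalgebra.smul_mem _ hv _
  | zero => exact zero_mem _
  | add f f' _ _ h h' => exact add_mem h h'
  | smul c f _ h => exact Subalgebra.smul_mem _ h _

/-- A regular function on `G × L` that takes values in `V(λ)` is a regular map `G → V(λ)`: a linear
projection onto `V(λ)` fixes the function and moves the second tensor factors into `V(λ)`. -/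
theorem mem_regularMaps_of_mem_regularPairs {lam : Fin n → ℤ} {f : symp n k → levi n k → k}
    (hf : f ∈ regularPairs n k) (hfg : ∀ g, f g ∈ indRep n k lam) :
    f ∈ regularMaps n k lam := by
  obtain ⟨π, hπ⟩ := LinearMap.exists_leftInverse_of_injective (indRep n k lam).subtype
    (Submodule.ker_subtype _)
  have hπ' : ∀ v : indRep n k lam, π v = v := fun v => LinearMap.congr_fun hπ v
  have key : (fun g => (π (f g) : levi n k → k)) ∈ regularMaps n k lam := by
    clear hfg
    induction hf using Submodule.span_induction with
    | mem f hf =>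
      obtain ⟨c, hc, v, _, rfl⟩ := hf
      exact Submodule.subset_span ⟨c, hc, π v, (π v).2, by
        funext g
        rw [map_smul]
        rfl⟩
    | zero =>
      convert zero_mem (regularMaps n k lam) using 1
      funext g
      simp
    | add f f' _ _ h h' =>
      convert add_mem h h' using 1
      funext g
      simp
    | smul c f _ h =>
      convert Submodule.smul_mem _ c h using 1
      funext g
      simp
  convert key using 1
  funext g
  exact (congrArg Subtype.val (hπ' ⟨f g, hfg g⟩)).symm

/-- A polynomial in the block `A` that is equivariant of weight `λ` under lower triangular matrices
`b`, acting by `A ↦ b⁻¹ A φ(b)`, comes from a section of `𝒱(λ)`, namely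
`f(g)(l) = P(A(l)⁻¹ A(g) φ(A(l)))`. -/
theorem exists_zipSection (p : ℕ) [Fact p.Prime] [CharP k p] (lam : Fin n → ℤ)
    (P : MvPolynomial (Fin n × Fin n) k)
    (hP : ∀ b c M : Matrix (Fin n) (Fin n) k, c * b = 1 → (∀ i j, i < j → b i j = 0) →
      MvPolynomial.eval (fun ij => (c * M * b.map (frobenius k p)) ij.1 ij.2) P =
        (∏ i, b i i ^ lam i)⁻¹ * MvPolynomial.eval (fun ij => M ij.1 ij.2) P) :
    ∃ f ∈ zipSections p n k lam, ∀ g, f g 1 = pullbackA n k P g := by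
  let w : symp n k → levi n k → Matrix (Fin n) (Fin n) k := fun g l =>
    upperLeft (l : GLBlock n k)⁻¹ * upperLeft (g : GLBlock n k) *
      (upperLeft (l : GLBlock n k)).map (frobenius k p)
  let f : symp n k → levi n k → k := fun g l =>
    MvPolynomial.eval (fun ij => w g l ij.1 ij.2) P
  have hfrob : (1 : Matrix (Fin n) (Fin n) k).map (frobenius k p) = 1 :=
    Matrix.map_one _ (map_zero _) (map_one _)
  have hw : ∀ i j, (fun g l => w g l i j) ∈ regularPairs n k := by
    intro i j
    have : (fun g l => w g l i j) = ∑ b : Fin n, (∑ a : Fin n,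
        (fun (_ : symp n k) (l : levi n k) =>
            ((l : GLBlock n k)⁻¹ : GLBlock n k).val (Sum.inl i) (Sum.inl a)) *
          (fun (g : symp n k) (_ : levi n k) => (g : GLBlock n k).val (Sum.inl a) (Sum.inl b))) *
        (fun (_ : symp n k) (l : levi n k) =>
          (l : GLBlock n k).val (Sum.inl b) (Sum.inl j)) ^ p := by
      funext g l
      simp [w, Matrix.mul_apply, upperLeft, Matrix.toBlocks₁₁, frobenius_def]
    rw [this]
    refine Subalgebra.sum_mem _ fun b _ => mul_mem (Subalgebra.sum_mem _ fun a _ => mul_mem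
      ?_ ?_) (pow_mem ?_ p)
    · exact right_mem_regularPairs (inv_entry_mem_regularFunctions _ _ _)
    · exact left_mem_regularPairs (entry_mem_regularFunctions _ _ _)
    · exact right_mem_regularPairs (entry_mem_regularFunctions _ _ _)
  have hf : f ∈ regularPairs n k := by
    have : ∀ Q : MvPolynomial (Fin n × Fin n) k,
        (fun g l => MvPolynomial.eval (fun ij => w g l ij.1 ij.2) Q) ∈ regularPairs n k := by
      intro Q
      induction Q using MvPolynomial.induction_on with
      | C a =>
        simp only [MvPolynomial.eval_C]
        exact Subalgebra.algebraMap_mem (regularPairs n k) a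
      | add Q Q' h h' =>
        simp only [map_add]
        exact add_mem h h'
      | mul_X Q ij h =>
        simp only [map_mul, MvPolynomial.eval_X]
        exact mul_mem h (hw ij.1 ij.2)
    exact this P
  have hlevi : ∀ l : levi n k, (l : GLBlock n k).val.toBlocks₁₂ = 0 := fun l =>
    toBlocks₁₂_of_mem_parP l.2.1
  have hmul : ∀ l l' : levi n k, upperLeft ((l * l' : levi n k) : GLBlock n k) =
      upperLeft (l : GLBlock n k) * upperLeft (l' : GLBlock n k) := fun l l' =>
    upperLeft_mul_of_left (hlevi l)
  have hmem : ∀ g, f g ∈ indRep n k lam := by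
    intro g
    refine ⟨apply_mem_of_mem_regularPairs hf g, fun l b hb => ?_⟩
    have hb1 : upperLeft ((b : GLBlock n k)⁻¹) * upperLeft (b : GLBlock n k) = 1 :=
      upperLeft_inv_mul b.2.1.1 (Or.inl (hlevi b))
    have hwb : w g (l * b) = upperLeft ((b : GLBlock n k)⁻¹) * w g l *
        (upperLeft (b : GLBlock n k)).map (frobenius k p) := by
      have h1 : upperLeft (((l * b : levi n k) : GLBlock n k)⁻¹) =
          upperLeft ((b : GLBlock n k)⁻¹) * upperLeft ((l : GLBlock n k)⁻¹) := by
        have := hmul b⁻¹ l⁻¹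
        rwa [← _root_.mul_inv_rev] at this
      simp only [w]
      rw [h1, hmul, Matrix.map_mul]
      simp only [Matrix.mul_assoc]
    change MvPolynomial.eval (fun ij => w g (l * b) ij.1 ij.2) P = _
    rw [hwb, hP _ _ _ hb1 fun i j hij => ?_]
    · rfl
    · exact hb.1.2 (OrderDual.toDual_lt_toDual.2 (Sum.Lex.inl_lt_inl_iff.2 hij))
  refine ⟨f, ⟨mem_regularMaps_of_mem_regularPairs hf hmem, fun ε hε g => ?_⟩, fun g => ?_⟩
  · funext l
    have hx : (ε.1 : GLBlock n k).val.toBlocks₁₂ = 0 := toBlocks₁₂_of_mem_parP ε.1.2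
    have hy : ((ε.2 : GLBlock n k)⁻¹).val.toBlocks₂₁ = 0 :=
      toBlocks₂₁_inv ε.2.2.1 (toBlocks₂₁_of_mem_parQ ε.2.2)
    have hfy : (upperLeft ((ε.1 : GLBlock n k)⁻¹)).map (frobenius k p) =
        upperLeft ((ε.2 : GLBlock n k)⁻¹) :=
      congrArg upperLeft (inv_mem hε : ε⁻¹ ∈ zipGroup p n k)
    have hact : upperLeft (zipAct ε g : GLBlock n k) = upperLeft (ε.1 : GLBlock n k) *
        upperLeft (g : GLBlock n k) * upperLeft ((ε.2 : GLBlock n k)⁻¹) := by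
      change upperLeft ((ε.1 : GLBlock n k) * (g : GLBlock n k) * (ε.2 : GLBlock n k)⁻¹) = _
      rw [upperLeft_mul_of_right hy, upperLeft_mul_of_left hx]
    set m := leviProjP n k ε.1
    have hm : upperLeft (m : GLBlock n k) = upperLeft (ε.1 : GLBlock n k) := rfl
    have hm' : upperLeft ((m⁻¹ : levi n k) : GLBlock n k) =
      upperLeft ((ε.1 : GLBlock n k)⁻¹) := rfl
    have h1 : upperLeft (((m⁻¹ * l : levi n k) : GLBlock n k)⁻¹) =
        upperLeft ((l : GLBlock n k)⁻¹) * upperLeft (m : GLBlock n k) := by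
      have := hmul l⁻¹ m
      rwa [← inv_inv m, ← _root_.mul_inv_rev, inv_inv] at this
    have hww : w (zipAct ε g) l = w g (m⁻¹ * l) := by
      simp only [w]
      rw [hact, h1, hmul, hm, hm', Matrix.map_mul, hfy]
      simp only [Matrix.mul_assoc]
    change MvPolynomial.eval (fun ij => w (zipAct ε g) l ij.1 ij.2) P =
      MvPolynomial.eval (fun ij => w g (m⁻¹ * l) ij.1 ij.2) P
    rw [hww]
  · have hw1 : w g 1 = upperLeft (g : GLBlock n k) := by
      simp [w, upperLeft_one, hfrob]
    change MvPolynomial.eval (fun ij => w g 1 ij.1 ij.2) P = _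
    rw [hw1, pullbackA_apply]

end Construction

/-! ### Linear independence of the weights -/

section Injectivity

variable {n : ℕ} {k : Type*} [Field k]

/-- The character `t ↦ ∏ t_i^{-a_i}` of the torus `(kˣ)^n`. -/
def torusChar (a : Fin n → ℤ) : (Fin n → kˣ) →* k where
  toFun t := (∏ i, (t i : k) ^ a i)⁻¹
  map_one' := by simp
  map_mul' t t' := by
    simp [mul_zpow, Finset.prod_mul_distrib, mul_comm]

theorem torusChar_injective [IsAlgClosed k] :
    Function.Injective (torusChar : (Fin n → ℤ) → (Fin n → kˣ) →* k) := by
  have : Infinite k := IsAlgClosed.instInfinite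
  classical
  intro a a' h
  funext i
  by_contra hne
  obtain ⟨c, hc⟩ := Infinite.exists_notMem_finset ({0, 1} : Finset k)
  simp only [Finset.mem_insert, Finset.mem_singleton, not_or] at hc
  obtain ⟨u, hu⟩ := IsAlgClosed.exists_pow_nat_eq c
    (Int.natAbs_pos.2 (sub_ne_zero.2 hne) : 0 < (a i - a' i).natAbs)
  have hu0 : u ≠ 0 := by
    rintro rfl
    rw [zero_pow (Int.natAbs_pos.2 (sub_ne_zero.2 hne)).ne'] at hu
    exact hc.1 hu.symm
  have hval : ∀ b : Fin n → ℤ,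
      torusChar b (Pi.mulSingle i (Units.mk0 u hu0) : Fin n → kˣ) = (u ^ b i)⁻¹ := by
    intro b
    change (∏ j, (((Pi.mulSingle i (Units.mk0 u hu0) : Fin n → kˣ) j : kˣ) : k) ^ b j)⁻¹ = _
    rw [Finset.prod_eq_single i]
    · simp
    · intro j _ hj
      simp [Pi.mulSingle_eq_of_ne hj]
    · simp
  have h1 := DFunLike.congr_fun h (Pi.mulSingle i (Units.mk0 u hu0) : Fin n → kˣ)
  rw [hval, hval, _root_.inv_inj] at h1
  have h2 : u ^ (a i - a' i) = 1 := by
    rw [zpow_sub₀ hu0, h1, div_self (zpow_ne_zero _ hu0)]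
  rcases Int.natAbs_eq (a i - a' i) with h3 | h3 <;> rw [h3] at h2
  · rw [zpow_natCast, hu] at h2
    exact hc.2 h2
  · rw [_root_.zpow_neg, zpow_natCast, hu, inv_eq_one] at h2
    exact hc.2 h2

variable {p : ℕ} [Fact p.Prime] [CharP k p]

theorem zipRingToFun_of (lam : domWeights n) (f : zipSections p n k (lam : Fin n → ℤ)) :
    zipRingToFun p n k (DirectSum.of (fun lam : domWeights n =>
      zipSections p n k (lam : Fin n → ℤ)) lam f) = fun g => f.1 g 1 := by
  funext g
  simp only [zipRingToFun, AlgHom.comp_apply, DirectSum.coeAlgHom_of]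
  rfl

open Classical in
theorem zipRingToFun_apply (s : zipRing p n k) (g : symp n k) :
    zipRingToFun p n k s g = ∑ lam ∈ DFinsupp.support s, (s lam).1 g 1 := by
  conv_lhs => rw [← DirectSum.sum_support_of s]
  rw [map_sum, Finset.sum_apply]
  exact Finset.sum_congr rfl fun lam _ => by rw [zipRingToFun_of]

/-- Sections of different weights transform under the torus by different characters, and distinct
characters are linearly independent. -/
theorem zipRingToFun_injective [IsAlgClosed k] : Function.Injective (zipRingToFun p n k) := by
  classical
  rw [injective_iff_map_eq_zero]
  intro s hs
  have hli : LinearIndependent k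
      (fun lam : domWeights n => (torusChar (lam : Fin n → ℤ) : (Fin n → kˣ) → k)) :=
    (linearIndependent_monoidHom (Fin n → kˣ) k).comp
      (fun lam : domWeights n => (torusChar (lam : Fin n → ℤ) : (Fin n → kˣ) →* k))
      fun _ _ h => Subtype.ext (torusChar_injective h)
  have hcoef : ∀ lam ∈ DFinsupp.support s, ∀ g, (s lam).1 g 1 = 0 := by
    intro lam hlam g
    refine linearIndependent_iff'.1 hli (DFinsupp.support s) (fun lam => (s lam).1 g 1) ?_ lam hlam
    funext t
    let D : Matrix (Fin n) (Fin n) k := Matrix.diagonal fun i => (t i : k)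
    have hD : IsUnit D.det := by
      rw [Matrix.det_diagonal]
      exact isUnit_iff_ne_zero.2 (Finset.prod_ne_zero_iff.2 fun i _ => (t i).ne_zero)
    have hD' : IsUnit (D.map (frobenius k p)).det := by
      have := hD.map (frobenius k p)
      rwa [RingHom.map_det] at this
    have h1 := congrFun hs ((leviSymp D hD)⁻¹ * g * leviSymp (D.map (frobenius k p)) hD')
    rw [zipRingToFun_apply] at h1
    rw [Finset.sum_apply, Pi.zero_apply]
    refine Eq.trans (Finset.sum_congr rfl fun mu _ => ?_) h1
    rw [zipSections_apply_one_of_lower (s mu).2 (Matrix.toBlocks_fromBlocks₁₂ _ _ _ _)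
      (Matrix.toBlocks_fromBlocks₂₁ _ _ _ _) (by simp)
      (fun i j hij => by simp [D, Matrix.diagonal_apply_ne _ hij.ne])]
    simp [torusChar, D, mul_comm]
  ext lam : 1
  by_cases hlam : lam ∈ DFinsupp.support s
  · exact Subtype.ext (zipSections_eq_zero_of_apply_one (s lam).2 (hcoef lam hlam))
  · exact DFinsupp.notMem_support_iff.1 hlam

end Injectivity

/-! ### The image of the ring of zip automorphic forms -/

section Generators

variable {p : ℕ} [Fact p.Prime] {k : Type*} [Field k] [CharP k p]

/-- The relevant entries and the determinant of `b⁻¹ M φ(b)` for a lower triangular `b`. -/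
theorem lower_conj_apply {b c M : Matrix (Fin 2) (Fin 2) k} (hcb : c * b = 1)
    (hb : b 0 1 = 0) :
    b 0 0 ≠ 0 ∧ b 1 1 ≠ 0 ∧
    (c * M * b.map (frobenius k p)) 0 0 = (M 0 0 * b 0 0 ^ p + M 0 1 * b 1 0 ^ p) / b 0 0 ∧
    (c * M * b.map (frobenius k p)) 0 1 = M 0 1 * b 1 1 ^ p / b 0 0 ∧
    (c * M * b.map (frobenius k p)) 1 1 = (M 1 1 - b 1 0 / b 0 0 * M 0 1) * b 1 1 ^ (p - 1) ∧
    (c * M * b.map (frobenius k p)).det =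
      M.det * (b 0 0 ^ (p - 1) * b 1 1 ^ (p - 1)) := by
  have hp : p ≠ 0 := (Fact.out : p.Prime).ne_zero
  have h00 := congrFun (congrFun hcb 0) 0
  have h01 := congrFun (congrFun hcb 0) 1
  have h10 := congrFun (congrFun hcb 1) 0
  have h11 := congrFun (congrFun hcb 1) 1
  simp only [Matrix.mul_apply, Fin.sum_univ_two, hb, mul_zero, zero_add, Matrix.one_apply_eq,
    ne_eq, zero_ne_one, one_ne_zero, not_false_eq_true, Matrix.one_apply_ne] at h00 h01 h10 h11
  have ht : b 1 1 ≠ 0 := right_ne_zero_of_mul_eq_one h11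
  have hc01 : c 0 1 = 0 := (mul_eq_zero.1 h01).resolve_right ht
  rw [hc01, zero_mul, add_zero] at h00
  have hs : b 0 0 ≠ 0 := right_ne_zero_of_mul_eq_one h00
  have hc00 : c 0 0 = (b 0 0)⁻¹ := eq_inv_of_mul_eq_one_left h00
  have hc11 : c 1 1 = (b 1 1)⁻¹ := eq_inv_of_mul_eq_one_left h11
  have hc10 : c 1 0 = -((b 1 1)⁻¹ * b 1 0 * (b 0 0)⁻¹) := by
    rw [hc11] at h10
    rw [eq_neg_iff_add_eq_zero]
    field_simp at h10 ⊢
    linear_combination h10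
  have hpow : ∀ a : k, a ^ p = a * a ^ (p - 1) := fun a => (mul_pow_sub_one hp a).symm
  refine ⟨hs, ht, ?_, ?_, ?_, ?_⟩
  · simp only [Matrix.mul_apply, Fin.sum_univ_two, Matrix.map_apply, frobenius_def, hc00, hc01]
    field_simp
    ring
  · simp only [Matrix.mul_apply, Fin.sum_univ_two, Matrix.map_apply, frobenius_def, hc00, hc01, hb,
      zero_pow hp]
    field_simp
    ring
  · simp only [Matrix.mul_apply, Fin.sum_univ_two, Matrix.map_apply, frobenius_def, hc10, hc11, hb,
      zero_pow hp, hpow (b 1 1)]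
    field_simp
    ring
  · rw [Matrix.det_mul, Matrix.det_mul, Matrix.det_fin_two c, Matrix.det_fin_two (b.map _)]
    simp only [Matrix.map_apply, frobenius_def, hc00, hc01, hc11, hb, zero_pow hp,
      hpow (b 0 0), hpow (b 1 1)]
    field_simp
    ring

theorem exists_zipRingToFun_eq {lam : Fin 2 → ℤ} (hlam : Antitone lam)
    {P : MvPolynomial (Fin 2 × Fin 2) k}
    (h : ∃ f ∈ zipSections p 2 k lam, ∀ g, f g 1 = pullbackA 2 k P g) :
    pullbackA 2 k P ∈ (zipRingToFun p 2 k).range := by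
  obtain ⟨f, hf, hfP⟩ := h
  refine ⟨DirectSum.of (fun lam : domWeights 2 => zipSections p 2 k (lam : Fin 2 → ℤ))
    ⟨lam, hlam⟩ ⟨f, hf⟩, ?_⟩
  change zipRingToFun p 2 k _ = _
  rw [zipRingToFun_of]
  funext g
  exact hfP g

theorem antitone_fin_two {lam : Fin 2 → ℤ} (h : lam 1 ≤ lam 0) : Antitone lam := by
  intro i j hij
  fin_cases i <;> fin_cases j <;> first | exact le_rfl | exact h | exact absurd hij (by decide)

/-- `α` has weight `(0, -p(p-1))`, `Δ_1` has weight `(1, -p)`, and `Δ_2` has weight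
`(1-p, 1-p)`. -/
theorem pullbackA_zipGens_mem_range (i : Fin 3) :
    pullbackA 2 k (zipGens p k i) ∈ (zipRingToFun p 2 k).range := by
  have hp : p ≠ 0 := (Fact.out : p.Prime).ne_zero
  have hpow : ∀ a : k, a ^ p = a * a ^ (p - 1) := fun a => (mul_pow_sub_one hp a).symm
  fin_cases i
  · refine exists_zipRingToFun_eq (lam := ![0, -((p * (p - 1) : ℕ) : ℤ)])
      (antitone_fin_two (by simpa using Int.natCast_nonneg (p * (p - 1))))
      (exists_zipSection p _ _ fun b c M hcb hb => ?_)
    obtain ⟨hs, ht, e1, e2, e3, -⟩ := lower_conj_apply (p := p) (M := M) hcb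
      (hb 0 1 (by norm_num))
    change MvPolynomial.eval _ (alphaPoly p k) = _ * MvPolynomial.eval _ (alphaPoly p k)
    rw [eval_alphaPoly, eval_alphaPoly]
    dsimp only
    rw [e1, e2, e3, mul_pow, sub_pow_char, Fin.prod_univ_two]
    simp only [Matrix.cons_val_zero, Matrix.cons_val_one, zpow_zero, _root_.zpow_neg, zpow_natCast,
      one_mul, inv_inv]
    rw [pow_right_comm (b 1 1) (p - 1) p, pow_mul (b 1 1) p (p - 1)]
    simp only [mul_pow, div_pow]
    rw [hpow (M 0 1), hpow (b 0 0)]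
    generalize (b 1 1 ^ p) ^ (p - 1) = τ
    field_simp
    ring
  · refine exists_zipRingToFun_eq (lam := ![1, -(p : ℤ)])
      (antitone_fin_two (by simp))
      (exists_zipSection p _ _ fun b c M hcb hb => ?_)
    obtain ⟨hs, ht, -, e2, -, -⟩ := lower_conj_apply (p := p) (M := M) hcb
      (hb 0 1 (by norm_num))
    change MvPolynomial.eval _ (cornerMinor 2 k 1 (by norm_num)) =
      _ * MvPolynomial.eval _ (cornerMinor 2 k 1 (by norm_num))
    rw [cornerMinor_two_one, MvPolynomial.eval_X, MvPolynomial.eval_X]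
    dsimp only
    rw [e2, Fin.prod_univ_two]
    simp only [Matrix.cons_val_zero, Matrix.cons_val_one, zpow_one, _root_.zpow_neg, zpow_natCast,
      mul_inv, inv_inv]
    field_simp
  · refine exists_zipRingToFun_eq (lam := ![-((p - 1 : ℕ) : ℤ), -((p - 1 : ℕ) : ℤ)])
      (antitone_fin_two (by simp))
      (exists_zipSection p _ _ fun b c M hcb hb => ?_)
    obtain ⟨-, -, -, -, -, e4⟩ := lower_conj_apply (p := p) (M := M) hcb
      (hb 0 1 (by norm_num))
    change MvPolynomial.eval _ (cornerMinor 2 k 2 le_rfl) =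
      _ * MvPolynomial.eval _ (cornerMinor 2 k 2 le_rfl)
    rw [eval_cornerMinor_self, eval_cornerMinor_self, e4, Fin.prod_univ_two]
    simp only [Matrix.cons_val_zero, Matrix.cons_val_one, _root_.zpow_neg, zpow_natCast,
      mul_inv, inv_inv]
    ring

theorem zipRingToFun_range [IsAlgClosed k] : (zipRingToFun p 2 k).range =
    (Algebra.adjoin k (Set.range (zipGens p k))).map (pullbackA 2 k) := by
  apply le_antisymm
  · rintro _ ⟨s, rfl⟩
    change zipRingToFun p 2 k s ∈ _
    induction s using DirectSum.induction_on with
    | zero => rw [map_zero]; exact zero_mem _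
    | of lam f =>
      rw [zipRingToFun_of]
      obtain ⟨R, hR⟩ := exists_zipGens_of_mem_zipSections f.2
      rw [hR, Algebra.adjoin_range_eq_range_aeval]
      exact ⟨_, ⟨R, rfl⟩, rfl⟩
    | add s s' h h' => rw [map_add]; exact add_mem h h'
  · rw [AlgHom.map_adjoin, Algebra.adjoin_le_iff]
    rintro _ ⟨_, ⟨i, rfl⟩, rfl⟩
    exact pullbackA_zipGens_mem_range i

end Generators

theorem mainTheorem5 (p : ℕ) [Fact p.Prime] (k : Type*) [Field k] [CharP k p]
    [Algebra (ZMod p) k] [IsAlgClosure (ZMod p) k] :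
    Function.Injective (zipRingToFun p 2 k) ∧
    Function.Injective (pullbackA 2 k) ∧
    (∃ e : zipRing p 2 k ≃ₐ[k]
        Algebra.adjoin k {alphaPoly p k, cornerMinor 2 k 1 (by norm_num), cornerMinor 2 k 2 le_rfl},
      ∀ s : zipRing p 2 k, zipRingToFun p 2 k s =
        pullbackA 2 k (e s : MvPolynomial (Fin 2 × Fin 2) k)) ∧
    AlgebraicIndependent k
      ![alphaPoly p k, cornerMinor 2 k 1 (by norm_num), cornerMinor 2 k 2 le_rfl] ∧
    Nonempty (zipRing p 2 k ≃ₐ[k] MvPolynomial (Fin 3) k) := by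
  have : IsAlgClosed k := IsAlgClosure.isAlgClosed (ZMod p)
  have : Infinite k := IsAlgClosed.instInfinite
  have hinj : Function.Injective (zipRingToFun p 2 k) := zipRingToFun_injective
  have hA : Function.Injective (pullbackA 2 k) := pullbackA_injective
  have hind : AlgebraicIndependent k (zipGens p k) :=
    zipGens_algebraicIndependent p (Fact.out : p.Prime).ne_zero
  let e : zipRing p 2 k ≃ₐ[k] Algebra.adjoin k (Set.range (zipGens p k)) :=
    (AlgEquiv.ofInjective _ hinj).trans ((Subalgebra.equivOfEq _ _ zipRingToFun_range).trans
      (Subalgebra.equivMapOfInjective _ (pullbackA 2 k) hA).symm)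
  have he : ∀ s, zipRingToFun p 2 k s = pullbackA 2 k (e s) := by
    intro s
    rw [← Subalgebra.coe_equivMapOfInjective_apply _ _ hA]
    simp [e]
  refine ⟨hinj, hA, ?_, hind, ⟨e.trans hind.aevalEquiv.symm⟩⟩
  rw [← range_zipGens p]
  exact ⟨e, he⟩
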